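/- **Setting.** Let $T$ be a finite group (not necessarily abelian) and let $\mathfrak S_n(T)=T^n\rtimes\mathfrak S_n$ be the wreath product, with the standard inclusions $\mathfrak S_k(T)\subset\mathfrak S_n(T)$ for $k\le n$ and $\mathfrak S_\infty(T)=\bigcup_k\mathfrak S_k(T)$. For $g=(x_1,\dots,x_n)\tau$ let $\operatorname{supp} g=\{j:\tau(j)\ne j\text{ or }x_j\ne e_T\}$. To each cycle $(i_1\,i_2\cdots i_p)$ of $\tau$ (fixed letters are included, with $p=1$) attach the label $(\theta,p)$, where $\theta$ is the conjugacy class in $T$ of $x_{i_p}\cdots x_{i_1}$; $\operatorname{type}(g)$ is the multiset of all these labels other than $(\{e_T\},1)$. Write $|\operatorname{type}(g)|$ for the sum of the lengths $p$ in it and $l(\operatorname{type}(g))$ for the number of labels in it. A $(\theta,k)$-cycle is an element which, in some $\mathfrak S_n(T)$, is conjugate to an element of $\mathfrak S_k(T)$ whose only label (in $\mathfrak S_k(T)$) is $(\theta,k)$. Let $\widehat{\mathfrak S_n(T)}$ be the finite set of equivalence classes of irreducible complex representations of $\mathfrak S_n(T)$ (it is parametrized by the tuples $(\lambda^\zeta)_{\zeta\in\widehat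 T}$ of Young diagrams of total size $n$), with characters $\chi^\lambda$ and dimensions $\dim\lambda$. A probability $M$ on $\widehat{\mathfrak S_n(T)}$ and a normalized positive-definite central function $f$ on $\mathfrak S_n(T)$ correspond to each other by $f(g)=\sum_\lambda M(\lambda)\,\chi^\lambda(g)/\dim\lambda$. **Dynamics.** For $n\ge1$ let $P^{(n)}$ be the transition matrix on $\widehat{\mathfrak S_n(T)}$ $$P^{(n)}_{\lambda\mu}=\sum_{\nu\in\widehat{\mathfrak S_{n-1}(T)}}\kappa(\nu,\lambda)\,\kappa(\nu,\mu)\,\frac{\dim\mu}{n\,|T|\,\dim\lambda},$$ where $\kappa(\nu,\lambda)$ is the multiplicity of $\nu$ in the restriction of $\lambda$ to $\mathfrak S_{n-1}(T)$. Let $(Z^{(n)}_j)_{j\ge0}$ be a Markov chain with transition matrix $P^{(n)}$ and arbitrary initial distribution. Independently of it, let $N_s$ be the number of $j\ge1$ such that the sum of the first $j$ pausing times is at most $s$, where the pausing times are IID with a distribution $\psi$ on $(0,\infty)$. Put $X^{(n)}_s=Z^{(n)}_{N_s}$, let $M^{(n)}_s$ be the distribution of $X^{(n)}_s$, and let $f^{(n)}_s$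 be the function on $\mathfrak S_n(T)$ corresponding to $M^{(n)}_s$. Assume that $\psi$ has finite mean $m$ and that its characteristic function $\varphi$ satisfies $\int_{|\xi|\ge a}|\varphi(\xi)/\xi|\,d\xi<\infty$ for some $a>0$. **AFP.** A sequence of functions $f^{(n)}$ on $\mathfrak S_n(T)$ has the *approximate factorization property* (AFP) if for all $g,h\in\mathfrak S_\infty(T)$ with $\operatorname{supp}g\cap\operatorname{supp}h=\varnothing$, $$f^{(n)}(gh)=f^{(n)}(g)f^{(n)}(h)+o\Bigl(n^{-\frac12\left(|\operatorname{type}(g)|-l(\operatorname{type}(g))+|\operatorname{type}(h)|-l(\operatorname{type}(h))\right)}\Bigr)\qquad(n\to\infty).$$ **Proposition 4.4.** Suppose that $\{f^{(n)}_0\}_n$ satisfies AFP and that for every conjugacy class $\theta$ of $T$ and every $k\ge1$ the limit $\lim_{n\to\infty}n^{\frac{k-1}2}f^{(n)}_0(g_{\theta,k})$ exists in $\mathbb C$, where $g_{\theta,k}$ is a $(\theta,k)$-cycle. Then for every $t\ge0$ the sequence $\{f^{(n)}_{tn}\}_n$ satisfies AFP. -/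

import Mathlib

open MeasureTheory ProbabilityTheory Filter Asymptotics
open scoped Topology

noncomputable section

namespace WreathAFP

/-! ### Equivalence classes of irreducible representations of a finite group -/

section Irr

variable {G H : Type*} [Group G] [Group H]

/-- An irreducible complex representation of `G` on some `ℂ^d`. Every irreducible complex
representation of a finite group is equivalent to one of these. -/
structure IrrRep (G : Type*) [Group G] where
  d : ℕ
  ρ : Representation ℂ G (Fin d → ℂ)
  irr : ρ.IsIrreducible

/-- Equivalence of irreducible representations. -/
instance IrrRep.setoid (G : Type*) [Group G] : Setoid (IrrRep G) where
  r V W := Nonempty (V.ρ.Equiv W.ρ)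
  iseqv :=
    ⟨fun _ => ⟨Representation.Equiv.refl _⟩, fun ⟨e⟩ => ⟨e.symm⟩, fun ⟨e⟩ ⟨f⟩ => ⟨e.trans f⟩⟩

/-- The dual object of `G`: the set of equivalence classes of irreducible complex
representations of `G`. -/
def Irr (G : Type*) [Group G] : Type _ := Quotient (IrrRep.setoid G)

/-- A representative of an equivalence class. -/
def Irr.rep (lam : Irr G) : IrrRep G := Quotient.out lam

/-- The irreducible character `χ^λ`. -/
def Irr.character (lam : Irr G) (g : G) : ℂ := lam.rep.ρ.character g

/-- The dimension `dim λ`. -/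
def Irr.dim (lam : Irr G) : ℕ := lam.rep.d

/-- For a homomorphism `i : H →* G` (in practice the inclusion of a subgroup), the multiplicity
of `ν` in the restriction of `λ` to `H`, i.e. the dimension of the space of `H`-intertwining maps
from `ν` to the restriction of `λ`. -/
def Irr.mult (i : H →* G) (nu : Irr H) (lam : Irr G) : ℕ :=
  Module.finrank ℂ
    (Representation.IntertwiningMap nu.rep.ρ
      (lam.rep.ρ.comp i : Representation ℂ H (Fin lam.rep.d → ℂ)))

theorem Irr.linearIndependent_character (G : Type*) [Group G] [Finite G] :
    LinearIndependent ℂ (fun lam : Irr G => lam.character) := by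
  classical
  have := Fintype.ofFinite G
  have hc : (Nat.card G : ℂ) ≠ 0 := by exact_mod_cast Nat.card_pos.ne'
  let _ : Invertible (Nat.card G : ℂ) := invertibleOfNonzero hc
  have orth : ∀ lam mu : Irr G, (Nat.card G : ℂ)⁻¹ *
      ∑ g : G, lam.character g * mu.character g⁻¹ = if lam = mu then 1 else 0 := by
    intro lam mu
    have := lam.rep.irr
    have := mu.rep.irr
    have h := Representation.char_orthonormal lam.rep.ρ mu.rep.ρ
    refine h.trans ?_
    congr 1
    apply propext
    constructor
    · rintro ⟨e⟩
      have : (Quotient.mk _ lam.rep : Irr G) = Quotient.mk _ mu.rep :=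
        Quotient.sound ⟨e.symm⟩
      rw [Irr.rep, Irr.rep] at this
      exact (Quotient.out_eq lam).symm.trans (this.trans (Quotient.out_eq mu))
    · rintro rfl
      exact ⟨Representation.Equiv.refl _⟩
  rw [linearIndependent_iff']
  intro s c hs mu hmu
  have h1 : (Nat.card G : ℂ)⁻¹ *
      ∑ g : G, (∑ lam ∈ s, c lam • lam.character) g * mu.character g⁻¹ = c mu := by
    have : ∀ g : G, (∑ lam ∈ s, c lam • lam.character) g * mu.character g⁻¹ =
        ∑ lam ∈ s, c lam * (lam.character g * mu.character g⁻¹) := by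
      intro g
      simp [Finset.sum_apply, Finset.sum_mul, mul_assoc]
    simp_rw [this]
    rw [Finset.sum_comm, Finset.mul_sum]
    have h2 : ∀ lam ∈ s, (Nat.card G : ℂ)⁻¹ *
        ∑ g : G, c lam * (lam.character g * mu.character g⁻¹) =
          c lam * (if lam = mu then 1 else 0) := by
      intro lam _
      rw [← orth, ← Finset.mul_sum]
      ring
    rw [Finset.sum_congr rfl h2]
    simp [hmu]
  rw [hs] at h1
  simpa using h1.symm

instance Irr.finite (G : Type*) [Group G] [Finite G] : Finite (Irr G) :=
  (Irr.linearIndependent_character G).finite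

instance Irr.fintype (G : Type*) [Group G] [Finite G] : Fintype (Irr G) := Fintype.ofFinite _

/-- The (finite) set `Irr G` is a discrete measurable space. -/
instance Irr.measurableSpace (G : Type*) [Group G] : MeasurableSpace (Irr G) := ⊤

/-- The function `f = ∑_λ M(λ) χ^λ / dim λ` on `G` associated with a weight `M` on `Irr G`. -/
def fourier [Finite G] (M : Irr G → ℝ) (g : G) : ℂ :=
  ∑ lam : Irr G, (M lam : ℂ) * (lam.character g / (lam.dim : ℂ))

end Irr

/-! ### Wreath products -/

section Wreath

variable {T : Type*} [Group T]

/-- The wreath product `𝔖_n(T) = T^n ⋊ 𝔖_n`; a permutation `τ` acts on `T^n` by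
`(τ • x) i = x (τ⁻¹ i)`. The element `x τ` has components `g.left = x` and `g.right = τ`. -/
abbrev Wr (T : Type*) [Group T] (n : ℕ) : Type _ :=
  (Fin n → T) ⋊[mulAutArrow (G := Equiv.Perm (Fin n)) (A := Fin n) (M := T)] Equiv.Perm (Fin n)

instance Wr.finite [Finite T] (n : ℕ) : Finite (Wr T n) :=
  Finite.of_equiv _ SemidirectProduct.equivProd.symm

/-- The inclusion `𝔖_k(T) ⊆ 𝔖_n(T)` for `k ≤ n`: put `e_T` in the new coordinates and
fix the new letters. -/
def incl {k n : ℕ} (h : k ≤ n) : Wr T k →* Wr T n :=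
  SemidirectProduct.map (Function.ExtendByOne.hom T (Fin.castLE h))
    (Equiv.Perm.viaEmbeddingHom (Fin.castLEEmb h)) (by
      intro σ
      ext t i
      have hinj : Function.Injective (Fin.castLE h) := Fin.castLE_injective h
      have hval : ∀ (π : Equiv.Perm (Fin k)) (j : Fin k),
          (π.viaEmbedding (Fin.castLEEmb h)) (Fin.castLE h j) = Fin.castLE h (π j) :=
        fun π j => Equiv.Perm.viaEmbedding_apply π (Fin.castLEEmb h) j
      change Function.extend (Fin.castLE h) (fun j => t (σ⁻¹ j)) 1 i =
        Function.extend (Fin.castLE h) t 1 ((Equiv.Perm.viaEmbeddingHom (Fin.castLEEmb h) σ)⁻¹ i)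
      rw [← map_inv, Equiv.Perm.viaEmbeddingHom_apply]
      by_cases hi : ∃ j, Fin.castLE h j = i
      · obtain ⟨j, rfl⟩ := hi
        rw [hval, hinj.extend_apply, hinj.extend_apply]
      · rw [Function.extend_apply' _ _ _ hi,
          Equiv.Perm.viaEmbedding_apply_of_notMem _ _ _ (fun ⟨j, hj⟩ => hi ⟨j, hj⟩),
          Function.extend_apply' _ _ _ hi])

/-- The support of `g = x τ`: the letters `j` with `τ j ≠ j` or `x_j ≠ e_T`. -/
def supp {n : ℕ} (g : Wr T n) : Set (Fin n) := {j | g.right j ≠ j ∨ g.left j ≠ 1}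

/-- The length of the cycle of `g` through the letter `i` (it is `1` for a fixed letter). -/
def cycleLength {n : ℕ} (g : Wr T n) (i : Fin n) : ℕ := Function.minimalPeriod g.right i

/-- If `(i_1 i_2 ⋯ i_p)` is the cycle of `g` through `i = i_p`, this is the product
`x_{i_p} ⋯ x_{i_2} x_{i_1}`. -/
def cycleProd {n : ℕ} (g : Wr T n) (i : Fin n) : T :=
  ((List.range (cycleLength g i)).map fun j => g.left ((g.right⁻¹ ^ j) i)).prod

/-- The label of the cycle of `g` through `i`: the conjugacy class of the cycle product,
together with the length of the cycle. -/
def cycleLabel {n : ℕ} (g : Wr T n) (i : Fin n) : ConjClasses T × ℕ :=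
  (ConjClasses.mk (cycleProd g i), cycleLength g i)

theorem cycleLabel_apply {n : ℕ} (g : Wr T n) (i : Fin n) :
    cycleLabel g (g.right i) = cycleLabel g i := by
  have hper : i ∈ Function.periodicPts g.right :=
    (g.right.injective).mem_periodicPts i
  have hlen : cycleLength g (g.right i) = cycleLength g i :=
    Function.minimalPeriod_apply hper
  have hpos : 0 < cycleLength g i := Function.minimalPeriod_pos_of_mem_periodicPts hper
  obtain ⟨q, hq⟩ : ∃ q, cycleLength g i = q + 1 := ⟨_, (Nat.succ_pred_eq_of_pos hpos).symm⟩
  have hback : (g.right⁻¹ ^ q) i = g.right i := by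
    have h1 : (g.right ^ (q + 1)) i = i := by
      have := Function.iterate_minimalPeriod (f := g.right) (x := i)
      rw [Equiv.Perm.coe_pow, ← hq]
      exact this
    rw [inv_pow, Equiv.Perm.inv_eq_iff_eq]
    rw [pow_succ, Equiv.Perm.mul_apply] at h1
    exact h1.symm
  refine Prod.ext ?_ hlen
  show ConjClasses.mk _ = ConjClasses.mk _
  rw [ConjClasses.mk_eq_mk_iff_isConj, isConj_comm, isConj_iff]
  refine ⟨g.left (g.right i), ?_⟩
  unfold cycleProd
  rw [hlen, hq]
  have e1 : ((List.range (q + 1)).map fun j => g.left ((g.right⁻¹ ^ j) i)).prod =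
      ((List.range q).map fun j => g.left ((g.right⁻¹ ^ j) i)).prod * g.left (g.right i) := by
    rw [List.range_succ, List.map_append, List.prod_append, List.map_singleton,
      List.prod_singleton, hback]
  have e2 : ((List.range (q + 1)).map fun j => g.left ((g.right⁻¹ ^ j) (g.right i))).prod =
      g.left (g.right i) * ((List.range q).map fun j => g.left ((g.right⁻¹ ^ j) i)).prod := by
    rw [List.range_succ_eq_map, List.map_cons, List.prod_cons, List.map_map]
    have e3 : ∀ j : ℕ, (g.right⁻¹ ^ (j + 1)) (g.right i) = (g.right⁻¹ ^ j) i := by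
      intro j
      rw [pow_succ, Equiv.Perm.mul_apply]
      exact congrArg _ (g.right.symm_apply_apply i)
    simp only [Function.comp_def, Nat.succ_eq_add_one, e3, pow_zero, Equiv.Perm.one_apply]
  rw [e1, e2, mul_assoc, mul_assoc, mul_inv_cancel, mul_one]

/-- The type of `g ∈ 𝔖_n(T)` as an element `(ρ_θ)_{θ ∈ [T]}` of `𝕐_n([T])`. It is
recorded as the multiset of all labelled rows `(θ, j)`, a row of length `j` of the diagram `ρ_θ`;
there is one labelled row for every cycle of `g`, including the fixed letters. -/
def fullType {n : ℕ} (g : Wr T n) : Multiset (ConjClasses T × ℕ) :=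
  letI := Fintype.ofFinite (Quotient (Equiv.Perm.SameCycle.setoid g.right))
  (Finset.univ : Finset (Quotient (Equiv.Perm.SameCycle.setoid g.right))).val.map
    (Quotient.lift (cycleLabel g) (by
      have key : ∀ (m : ℕ) (i : Fin n), cycleLabel g ((g.right ^ m) i) = cycleLabel g i := by
        intro m
        induction m with
        | zero => intro i; rfl
        | succ m ih => intro i; rw [pow_succ', Equiv.Perm.mul_apply, cycleLabel_apply, ih]
      rintro a b hab
      obtain ⟨m, hm⟩ := (show Equiv.Perm.SameCycle g.right a b from hab).exists_nat_pow_eq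
      rw [← hm, key]))

open Classical in
/-- `type(g)`: remove from `fullType g` the rows of length `1` of the `{e_T}`-entry. -/
def redType {n : ℕ} (g : Wr T n) : Multiset (ConjClasses T × ℕ) :=
  (fullType g).filter (fun r => r ≠ (ConjClasses.mk 1, 1))

/-- The total size `|ρ|` of a multi-diagram. -/
def size (r : Multiset (ConjClasses T × ℕ)) : ℕ := (r.map Prod.snd).sum

/-- The total number of rows `l(ρ)` of a multi-diagram. -/
def length (r : Multiset (ConjClasses T × ℕ)) : ℕ := Multiset.card r

/-- The value `f^{(n)}(g)` at an element `g ∈ 𝔖_k(T) ⊆ 𝔖_∞(T)`, which makes sense for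
`n ≥ k`; the (irrelevant) value for `n < k` is set to `0`. -/
def eval (f : ∀ n, Wr T n → ℂ) {k : ℕ} (g : Wr T k) (n : ℕ) : ℂ :=
  if h : k ≤ n then f n (incl h g) else 0

/-- Approximate factorization property of a sequence of functions `f^{(n)}` on `𝔖_n(T)`.
Any two elements of `𝔖_∞(T) = ⋃_k 𝔖_k(T)` lie in a common `𝔖_k(T)`. -/
def AFP (f : ∀ n, Wr T n → ℂ) : Prop :=
  ∀ (k : ℕ) (g h : Wr T k), Disjoint (supp g) (supp h) →
    (fun n : ℕ => eval f (g * h) n - eval f g n * eval f h n) =o[atTop]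
      fun n : ℕ => (n : ℝ) ^ (-(1 / 2 : ℝ) *
        (((size (redType g) : ℝ) - length (redType g)) +
          ((size (redType h) : ℝ) - length (redType h))))

/-- Convergence of the suitably rescaled values at `(θ, k)`-cycles: for all `θ ∈ [T]` and
`k ≥ 1` the limit of `n^{(k-1)/2} f^{(n)}(g)` exists, where `g` is a `(θ, k)`-cycle. -/
def CycleLimits (f : ∀ n, Wr T n → ℂ) : Prop :=
  ∀ (θ : ConjClasses T) (k : ℕ), 1 ≤ k → ∃ γ : ℂ, ∀ g : Wr T k, fullType g = {(θ, k)} →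
    Tendsto (fun n : ℕ => (((n : ℝ) ^ (((k : ℝ) - 1) / 2) : ℝ) : ℂ) * eval f g n)
      atTop (𝓝 γ)

end Wreath

/-! ### The Res-Ind chain and its continuous time version -/

section Dynamics

variable {T : Type*} [Group T] [Finite T]

/-- The transition matrix `P^{(n)}` of the Res-Ind chain on the dual object of `𝔖_n(T)`
(meaningful for `n ≥ 1`):
`P_{λμ} = ∑_ν κ(ν, λ) κ(ν, μ) dim μ / (n |T| dim λ)`,
where `ν` runs over the irreducible representations of `𝔖_{n-1}(T)` and `κ` denotes the
multiplicity in the restriction from `𝔖_n(T)` to `𝔖_{n-1}(T)` (the number of edges from `ν`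
to `λ` in the branching graph). -/
def resInd (n : ℕ) (lam mu : Irr (Wr T n)) : ℝ :=
  ∑ nu : Irr (Wr T (n - 1)),
    (Irr.mult (incl (Nat.sub_le n 1)) nu lam : ℝ) * (Irr.mult (incl (Nat.sub_le n 1)) nu mu : ℝ) *
      ((mu.dim : ℝ) / ((n : ℝ) * (Nat.card T : ℝ) * (lam.dim : ℝ)))

variable {Ω : Type*} [MeasurableSpace Ω]

/-- `Z` is a Markov chain with transition matrix `P^{(n)}` (and arbitrary initial distribution),
and `τ` is an IID sequence of pausing times with distribution `ψ`, independent of the chain `Z`;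
all on the probability space `(Ω, P)`. -/
structure IsResIndDynamics (n : ℕ) (ψ : Measure ℝ) (P : Measure Ω)
    (Z : ℕ → Ω → Irr (Wr T n)) (τ : ℕ → Ω → ℝ) : Prop where
  measurable_chain : ∀ j, Measurable (Z j)
  measurable_pausing : ∀ j, Measurable (τ j)
  markov : ∀ (j : ℕ) (z : ℕ → Irr (Wr T n)),
    P.real {ω | ∀ i ≤ j, Z i ω = z i} =
      P.real {ω | Z 0 ω = z 0} * ∏ i ∈ Finset.range j, resInd n (z i) (z (i + 1))
  law_pausing : ∀ j, P.map (τ j) = ψ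
  iid_pausing : iIndepFun τ P
  indep : IndepFun (fun ω (j : ℕ) => Z j ω) (fun ω (j : ℕ) => τ j ω) P

/-- The counting process `N_s`: the number of `j ≥ 1` such that the sum of the first `j`
pausing times is at most `s`. -/
def counting (τ : ℕ → Ω → ℝ) (s : ℝ) (ω : Ω) : ℕ :=
  Set.ncard {j : ℕ | ∑ i ∈ Finset.range (j + 1), τ i ω ≤ s}

/-- The distribution of `X_s = Z_{N_s}`. -/
def lawAt {n : ℕ} (P : Measure Ω) (Z : ℕ → Ω → Irr (Wr T n)) (τ : ℕ → Ω → ℝ) (s : ℝ)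
    (lam : Irr (Wr T n)) : ℝ :=
  P.real {ω | Z (counting τ s ω) ω = lam}

end Dynamics

end WreathAFP

end

/-! One step of the chain restricts to 𝔖_{n-1}(T) and induces back. The composite Ind Res is
tensoring with the permutation representation on 𝔖_n(T)/𝔖_{n-1}(T), realized on `Fin n × T`, where g
has |T|(n - |supp g|) fixed points. So each step multiplies the value at g by 1 - |supp g|/n
(`sum_resInd_mul_character`), and averaging over the independent clock gives f_s(g) = E[(1 - |supp
g|/n)^{N_s}] f_0(g) (`IsResIndDynamics.fourier_lawAt`).

By the strong law N_{tn}/n → t/m almost surely, so for t > 0 the factor E_g in front of f_0(g) tends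
to exp(-t |supp g|/m) (`tendsto_integral_one_sub_div_pow`). This limit is multiplicative on elements
with disjoint supports.

No rate of convergence is needed. Write f for the function at time 0 and F for the one at time tn;
then F(gh) - F(g)F(h) = E_{gh} (f(gh) - f(g)f(h)) + (E_{gh} - E_g E_h) f(g)f(h). The first term is
small by AFP at time 0. In the second the bracket is o(1), so it suffices that f(g) = O(n^{-(|type
g| - l(type g))/2}). This is `AFP.isBigO_eval`: AFP peels off one cycle at a time, and the cycle
limits bound each cycle. `AFP.mul_factor` puts the two terms together. -/

noncomputable section

namespace WreathAFP


/-! ### Character theory of finite groups and the operator Ind Res. -/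

section Characters

variable {G H : Type*} [Group G] [Group H]

/-- The character of a direct sum of two complementary subrepresentations. -/
theorem character_eq_add_of_isCompl {V : Type*} [AddCommGroup V] [Module ℂ V]
    [FiniteDimensional ℂ V] {ρ : Representation ℂ G V} {p q : Subrepresentation ρ}
    (h : IsCompl p.toSubmodule q.toSubmodule) :
    ρ.character = p.toRepresentation.character + q.toRepresentation.character := by
  ext g
  have e := LinearMap.trace_conj' (LinearMap.prodMap (p.toRepresentation g) (q.toRepresentation g))
    (Submodule.prodEquivOfIsCompl _ _ h)
  rw [LinearMap.trace_prodMap'] at e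
  rw [Pi.add_apply]
  refine Eq.trans ?_ e
  unfold Representation.character
  congr 1
  ext v
  obtain ⟨w, rfl⟩ := (Submodule.prodEquivOfIsCompl _ _ h).surjective v
  simp [LinearEquiv.conj_apply, Submodule.coe_prodEquivOfIsCompl']
  rfl

theorem isCompl_toSubmodule {V : Type*} [AddCommGroup V] [Module ℂ V]
    {ρ : Representation ℂ G V} {p q : Subrepresentation ρ} (h : IsCompl p q) :
    IsCompl p.toSubmodule q.toSubmodule := by
  refine ⟨?_, ?_⟩
  · rw [disjoint_iff, ← Subrepresentation.toSubmodule_inf, h.inf_eq_bot]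
    rfl
  · rw [codisjoint_iff, ← Subrepresentation.toSubmodule_sup, h.sup_eq_top]
    rfl

/-- `IrrRep` only contains representations on coordinate spaces, so ρ is transported along a basis;
characters do not see the isomorphism, nor the choice of representative in the class. -/
theorem character_mem_range_of_irreducible {V : Type*} [AddCommGroup V] [Module ℂ V]
    [FiniteDimensional ℂ V] (ρ : Representation ℂ G V) (hρ : ρ.IsIrreducible) :
    ∃ lam : Irr G, ρ.character = lam.character := by
  let e := (Module.finBasis ℂ V).equivFun
  let σ : Representation ℂ G (Fin (Module.finrank ℂ V) → ℂ) :=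
    { toFun := fun g => e.conj (ρ g)
      map_one' := by ext; simp
      map_mul' := fun a b => by ext; simp [LinearEquiv.conj_apply] }
  let φ : ρ.Equiv σ := Representation.Equiv.mk e (fun g => by
    ext v
    simp [σ, LinearEquiv.conj_apply])
  have hσ : σ.IsIrreducible := by
    rw [Representation.irreducible_iff_isSimpleModule_asModule] at hρ ⊢
    have hb : Function.Bijective
        (Representation.IntertwiningMap.equivLinearMapAsModule ρ σ φ.toIntertwiningMap) :=
      e.bijective
    exact IsSimpleModule.congr (LinearEquiv.ofBijective _ hb).symm
  let W : IrrRep G := ⟨_, σ, hσ⟩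
  refine ⟨Quotient.mk _ W, ?_⟩
  obtain ⟨ψ⟩ : Nonempty (Representation.Equiv (Irr.rep (Quotient.mk _ W)).ρ W.ρ) :=
    Quotient.exact (Quotient.out_eq (Quotient.mk _ W : Irr G))
  rw [Representation.char_iso φ]
  exact (Representation.char_iso ψ).symm

/-- Maschke's theorem, by induction on a bound for the dimension, so that both summands of a
splitting fall under the induction hypothesis. -/
theorem character_mem_span [Finite G] (n : ℕ) : ∀ {V : Type*} [AddCommGroup V] [Module ℂ V]
    [FiniteDimensional ℂ V] (ρ : Representation ℂ G V), Module.finrank ℂ V ≤ n →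
    ρ.character ∈ Submodule.span ℂ (Set.range fun lam : Irr G => lam.character) := by
  induction n with
  | zero =>
    intro V _ _ _ ρ h
    have : Subsingleton V := Module.finrank_zero_iff.1 (Nat.le_zero.1 h)
    have h0 : ρ.character = 0 := by
      ext g
      simp [Representation.character, Subsingleton.elim (ρ g) 0]
    rw [h0]
    exact Submodule.zero_mem _
  | succ n ih =>
    intro V _ _ _ ρ h
    by_cases hn : Module.finrank ℂ V ≤ n
    · exact ih ρ hn
    have hnt : Nontrivial V := Module.nontrivial_of_finrank_pos (R := ℂ) (by omega)
    by_cases hirr : ρ.IsIrreducible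
    · obtain ⟨lam, hlam⟩ := character_mem_range_of_irreducible ρ hirr
      rw [hlam]
      exact Submodule.subset_span ⟨lam, rfl⟩
    have hnt' : Nontrivial (Subrepresentation ρ) := by
      refine ⟨⊥, ⊤, fun hbt => ?_⟩
      have := congrArg Subrepresentation.toSubmodule hbt
      exact bot_ne_top (α := Submodule ℂ V) this
    obtain ⟨p, hp0, hp1⟩ : ∃ p : Subrepresentation ρ, p ≠ ⊥ ∧ p ≠ ⊤ := by
      by_contra! hcon
      exact hirr ⟨fun p => (em (p = ⊥)).imp id (hcon p)⟩
    -- Invertibility of |G| in ℂ is what makes the lattice of subrepresentations complemented.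
    have hcard : NeZero (Nat.card G : ℂ) := ⟨by exact_mod_cast Nat.card_pos.ne'⟩
    obtain ⟨q, hq⟩ := exists_isCompl p
    have hq' := isCompl_toSubmodule hq
    have hsum := Submodule.finrank_add_eq_of_isCompl hq'
    have hp0' : p.toSubmodule ≠ ⊥ := fun h => hp0 (Subrepresentation.toSubmodule_injective h)
    have hq0' : q.toSubmodule ≠ ⊥ := fun h =>
      hp1 (by rw [eq_top_iff, ← hq.sup_eq_top,
        show q = ⊥ from Subrepresentation.toSubmodule_injective h, sup_bot_eq])
    have h1 := Submodule.one_le_finrank_iff.2 hp0'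
    have h2 := Submodule.one_le_finrank_iff.2 hq0'
    rw [character_eq_add_of_isCompl hq']
    exact Submodule.add_mem _ (ih _ (by omega)) (ih _ (by omega))

/-- The scalar product of class functions on a finite group (bilinear version). -/
def charInner [Fintype G] (φ χ : G → ℂ) : ℂ := (Nat.card G : ℂ)⁻¹ * ∑ g : G, φ g * χ g⁻¹

theorem charInner_character [Fintype G] (lam mu : Irr G) [Decidable (lam = mu)] :
    charInner lam.character mu.character = if lam = mu then 1 else 0 := by
  classical
  have hc : (Nat.card G : ℂ) ≠ 0 := by exact_mod_cast Nat.card_pos.ne'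
  let _ : Invertible (Nat.card G : ℂ) := invertibleOfNonzero hc
  have := lam.rep.irr
  have := mu.rep.irr
  have h := Representation.char_orthonormal lam.rep.ρ mu.rep.ρ
  refine h.trans ?_
  refine if_congr ⟨?_, ?_⟩ rfl rfl
  · rintro ⟨e⟩
    have : (Quotient.mk _ lam.rep : Irr G) = Quotient.mk _ mu.rep :=
      Quotient.sound ⟨e.symm⟩
    rw [Irr.rep, Irr.rep] at this
    exact (Quotient.out_eq lam).symm.trans (this.trans (Quotient.out_eq mu))
  · rintro rfl
    exact ⟨Representation.Equiv.refl _⟩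

theorem charInner_eq_finrank [Fintype G] {V W : Type*} [AddCommGroup V] [Module ℂ V]
    [FiniteDimensional ℂ V] [AddCommGroup W] [Module ℂ W] [FiniteDimensional ℂ W]
    (ρ : Representation ℂ G V) (σ : Representation ℂ G W) :
    charInner σ.character ρ.character =
      Module.finrank ℂ (Representation.IntertwiningMap ρ σ) := by
  have hc : (Nat.card G : ℂ) ≠ 0 := by exact_mod_cast Nat.card_pos.ne'
  let _ : Invertible (Nat.card G : ℂ) := invertibleOfNonzero hc
  exact Representation.card_inv_mul_sum_char_mul_char_eq_finrank ρ σ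

theorem charInner_sum [Fintype G] {ι : Type*} (s : Finset ι) (c : ι → ℂ) (φ : ι → G → ℂ)
    (χ : G → ℂ) : charInner (fun g => ∑ i ∈ s, c i * φ i g) χ =
      ∑ i ∈ s, c i * charInner (φ i) χ := by
  simp only [charInner, Finset.sum_mul, Finset.mul_sum]
  rw [Finset.sum_comm]
  exact Finset.sum_congr rfl fun i _ => Finset.sum_congr rfl fun g _ => by ring

/-- Expansion of the character of a finite-dimensional representation into irreducible ones. -/
theorem character_eq_sum_charInner [Fintype G] {V : Type*} [AddCommGroup V] [Module ℂ V]
    [FiniteDimensional ℂ V] (ρ : Representation ℂ G V) (g : G) :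
    ρ.character g = ∑ mu : Irr G, charInner ρ.character mu.character * mu.character g := by
  classical
  have h := character_mem_span _ ρ le_rfl
  rw [Submodule.mem_span_range_iff_exists_fun] at h
  obtain ⟨c, hc⟩ := h
  have hc' : ρ.character = fun g => ∑ mu : Irr G, c mu * mu.character g := by
    rw [← hc]
    ext g
    simp [Finset.sum_apply]
  have hcoef : ∀ mu : Irr G, charInner ρ.character mu.character = c mu := by
    intro mu
    rw [hc', charInner_sum]
    simp [charInner_character]
  simp_rw [hcoef]
  rw [hc']

theorem Irr.dim_ne_zero (lam : Irr G) : lam.dim ≠ 0 := by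
  intro h
  have := lam.rep.irr
  have : Nontrivial (Subrepresentation lam.rep.ρ) := this.toNontrivial
  obtain ⟨p, q, hpq⟩ := this
  have : IsEmpty (Fin lam.rep.d) := by
    change lam.rep.d = 0 at h
    rw [h]
    infer_instance
  exact hpq (Subrepresentation.toSubmodule_injective (Subsingleton.elim _ _))

/-- Multiplicity in a restriction as a scalar product of characters. -/
theorem Irr.mult_eq_charInner [Fintype H] (i : H →* G) (nu : Irr H) (lam : Irr G) :
    (Irr.mult i nu lam : ℂ) = charInner (fun h => lam.character (i h)) nu.character :=
  (charInner_eq_finrank nu.rep.ρ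
    (lam.rep.ρ.comp i : Representation ℂ H (Fin lam.rep.d → ℂ))).symm

theorem Irr.character_restrict [Fintype H] (i : H →* G) (lam : Irr G) (h : H) :
    lam.character (i h) = ∑ nu : Irr H, (Irr.mult i nu lam : ℂ) * nu.character h := by
  simp_rw [Irr.mult_eq_charInner]
  exact character_eq_sum_charInner (lam.rep.ρ.comp i : Representation ℂ H (Fin lam.rep.d → ℂ)) h

theorem charInner_comm [Fintype G] (φ χ : G → ℂ) : charInner φ χ = charInner χ φ := by
  unfold charInner
  congr 1
  rw [← Equiv.sum_comp (Equiv.inv G)]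
  exact Finset.sum_congr rfl fun g _ => by simp [mul_comm]

/-- Parseval for the two restrictions, expanded in the irreducible characters of H. -/
theorem Irr.sum_mult_mul_mult [Fintype H] (i : H →* G) (lam mu : Irr G) :
    ∑ nu : Irr H, (Irr.mult i nu lam : ℂ) * (Irr.mult i nu mu : ℂ) =
      charInner (fun h => lam.character (i h)) (fun h => mu.character (i h)) := by
  simp_rw [Irr.character_restrict i lam]
  rw [charInner_sum]
  refine Finset.sum_congr rfl fun nu _ => ?_
  rw [Irr.mult_eq_charInner i nu mu, charInner_comm]

/-- The permutation representation on functions attached to an action by permutations. -/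
def permRep {X : Type*} (a : G →* Equiv.Perm X) : Representation ℂ G (X → ℂ) where
  toFun g := LinearMap.funLeft ℂ ℂ (a g⁻¹)
  map_one' := by ext; simp [LinearMap.funLeft]
  map_mul' x y := by ext; simp [LinearMap.funLeft]

theorem character_permRep {X : Type*} [Fintype X] [DecidableEq X] (a : G →* Equiv.Perm X) (g : G) :
    (permRep a).character g = ∑ x : X, if a g x = x then 1 else 0 := by
  rw [Representation.character, LinearMap.trace_eq_matrix_trace ℂ (Pi.basisFun ℂ X), Matrix.trace]
  refine Finset.sum_congr rfl fun x _ => ?_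
  -- Functions are pulled back along the inverse, but g and its inverse fix the same points.
  have h : (a g)⁻¹ x = x ↔ a g x = x := by rw [Equiv.Perm.inv_eq_iff_eq, eq_comm]
  simp [permRep, LinearMap.funLeft, Pi.single_apply, ← h]

/-- For a transitive action whose point stabilizer is the image of `i`, the operator `Ind Res`
multiplies an irreducible character by the number of fixed points. -/
theorem Irr.sum_mult_mul_character [Fintype G] [Fintype H] {X : Type*} [Fintype X] [DecidableEq X]
    (a : G →* Equiv.Perm X) (i : H →* G) (hi : Function.Injective i) (o : X)
    (htrans : ∀ x, ∃ g, a g o = x) (hstab : ∀ g, a g o = o ↔ g ∈ i.range) (lam : Irr G) (g : G) :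
    ∑ mu : Irr G, (∑ nu : Irr H, (Irr.mult i nu lam : ℂ) * (Irr.mult i nu mu : ℂ)) *
      mu.character g = lam.character g * ∑ x : X, if a g x = x then 1 else 0 := by
  -- The right-hand side is the character of λ ⊗ ℂ[X]; it remains to identify its coefficients in
  -- the irreducible characters.
  have hchar : (lam.rep.ρ.tprod (permRep a)).character =
      fun g => lam.character g * ∑ x : X, if a g x = x then 1 else 0 := by
    ext g
    rw [Representation.char_tensor, Pi.mul_apply, character_permRep]
    rfl
  -- Orbit-stabilizer: every fibre of g ↦ g·o is a coset of the image of H.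
  have hcardX : Nat.card G = Fintype.card X * Nat.card H := by
    have e1 : Nat.card G = ∑ x : X, Nat.card {g : G // a g o = x} := by
      simp only [Nat.card_eq_fintype_card]
      rw [← Fintype.card_sigma]
      exact Fintype.card_congr (Equiv.sigmaFiberEquiv (fun g => a g o)).symm
    have e2 : ∀ x : X, Nat.card {g : G // a g o = x} = Nat.card H := by
      intro x
      obtain ⟨k, hk⟩ := htrans x
      refine (Nat.card_congr (Equiv.ofBijective
        (fun h : H => (⟨k * i h, ?_⟩ : {g : G // a g o = x})) ⟨?_, ?_⟩)).symm
      · rw [map_mul, Equiv.Perm.mul_apply, (hstab _).2 ⟨h, rfl⟩, hk]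
      · intro h h' hh
        exact hi (mul_left_cancel (congrArg Subtype.val hh))
      · rintro ⟨g, hg⟩
        obtain ⟨h, hh⟩ := (hstab (k⁻¹ * g)).1 (by
          rw [map_mul, Equiv.Perm.mul_apply, hg, ← hk, map_inv]; exact (a k).symm_apply_apply o)
        exact ⟨h, Subtype.ext (by simp [hh])⟩
    rw [e1]
    rw [Finset.sum_congr rfl fun x _ => e2 x]
    simp
  rw [← congrFun hchar g, character_eq_sum_charInner]
  refine Finset.sum_congr rfl fun mu _ => ?_
  congr 1
  rw [Irr.sum_mult_mul_mult, hchar]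
  unfold charInner
  -- The sum runs over the stabilizer of x. Conjugating by k with k·o = x carries it to the
  -- stabilizer of o, that is to i(H), and characters are conjugation invariant.
  have key : ∀ x : X, (∑ g : G, if a g x = x then lam.character g * mu.character g⁻¹ else 0) =
      ∑ h : H, lam.character (i h) * mu.character (i h)⁻¹ := by
    intro x
    obtain ⟨k, hk⟩ := htrans x
    rw [← Equiv.sum_comp (MulAut.conj k).toEquiv, ← Finset.sum_filter]
    symm
    refine Finset.sum_bij (fun h _ => i h) ?_ (fun _ _ _ _ h => hi h) ?_ ?_
    · intro h _
      simp [← hk, (hstab (i h)).2 ⟨h, rfl⟩]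
    · intro g hg
      have : a g o = o := by
        simpa [← hk] using hg
      obtain ⟨h, hh⟩ := (hstab g).1 this
      exact ⟨h, Finset.mem_univ _, hh⟩
    · intro h _
      have c1 : lam.character (k * i h * k⁻¹) = lam.character (i h) :=
        Representation.char_conj _ _ _
      have c2 : mu.character (k * i h * k⁻¹)⁻¹ = mu.character (i h)⁻¹ := by
        rw [show (k * i h * k⁻¹)⁻¹ = k * (i h)⁻¹ * k⁻¹ by group]
        exact Representation.char_conj _ _ _
      simp only [MulEquiv.toEquiv_eq_coe, EquivLike.coe_coe, MulAut.conj_apply]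
      rw [c1, c2]
  have hG : (Nat.card G : ℂ) = Fintype.card X * Nat.card H := by exact_mod_cast hcardX
  have hX0 : (Fintype.card X : ℂ) ≠ 0 := by
    have : Nonempty X := ⟨o⟩
    exact_mod_cast Fintype.card_ne_zero
  have hswap : ∑ g : G, lam.character g * (∑ x : X, if a g x = x then 1 else 0) *
      mu.character g⁻¹ = Fintype.card X * ∑ h : H, lam.character (i h) * mu.character (i h)⁻¹ := by
    rw [← nsmul_eq_mul, ← Finset.card_univ, ← Finset.sum_const, ← Finset.sum_congr rfl
      (fun x _ => key x), Finset.sum_comm]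
    refine Finset.sum_congr rfl fun g _ => ?_
    rw [Finset.mul_sum, Finset.sum_mul]
    exact Finset.sum_congr rfl fun x _ => by split_ifs <;> simp
  rw [hswap, hG, mul_inv]
  simp only [map_inv]
  field_simp

end Characters


/-! ### The imprimitive action and the eigenvalues of the Res-Ind chain. -/

section WreathAction

variable {T : Type*} [Group T]

theorem Wr.mul_left_apply {n : ℕ} (g h : Wr T n) (i : Fin n) :
    (g * h).left i = g.left i * h.left (g.right⁻¹ i) := rfl

theorem Wr.mul_right_apply {n : ℕ} (g h : Wr T n) (i : Fin n) :
    (g * h).right i = g.right (h.right i) := rfl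

theorem Wr.ext {n : ℕ} {g h : Wr T n} (hl : ∀ i, g.left i = h.left i)
    (hr : ∀ i, g.right i = h.right i) : g = h :=
  SemidirectProduct.ext (funext hl) (Equiv.ext hr)

theorem incl_left_castLE {k n : ℕ} (h : k ≤ n) (g : Wr T k) (j : Fin k) :
    (incl h g).left (Fin.castLE h j) = g.left j :=
  (Fin.castLE_injective h).extend_apply _ _ _

theorem incl_left_of_le {k n : ℕ} (h : k ≤ n) (g : Wr T k) {i : Fin n} (hi : k ≤ i) :
    (incl h g).left i = 1 :=
  Function.extend_apply' _ _ _ (by rintro ⟨j, rfl⟩; exact absurd j.2 (not_lt.2 hi))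

theorem incl_right_castLE {k n : ℕ} (h : k ≤ n) (g : Wr T k) (j : Fin k) :
    (incl h g).right (Fin.castLE h j) = Fin.castLE h (g.right j) :=
  Equiv.Perm.viaEmbedding_apply g.right (Fin.castLEEmb h) j

theorem incl_right_of_le {k n : ℕ} (h : k ≤ n) (g : Wr T k) {i : Fin n} (hi : k ≤ i) :
    (incl h g).right i = i :=
  Equiv.Perm.viaEmbedding_apply_of_notMem g.right (Fin.castLEEmb h) i
    (by rintro ⟨j, rfl⟩; exact absurd j.2 (not_lt.2 hi))

theorem incl_injective {k n : ℕ} (h : k ≤ n) : Function.Injective (incl (T := T) h) := by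
  intro g g' hg
  refine Wr.ext (fun i => ?_) (fun i => ?_)
  · rw [← incl_left_castLE h, hg, incl_left_castLE]
  · apply Fin.castLE_injective h
    rw [← incl_right_castLE h, hg, incl_right_castLE]

theorem incl_incl {k l n : ℕ} (h : k ≤ l) (h' : l ≤ n) (g : Wr T k) :
    incl h' (incl h g) = incl (h.trans h') g := by
  refine Wr.ext (fun i => ?_) (fun i => ?_)
  · by_cases hi : l ≤ i
    · rw [incl_left_of_le _ _ hi, incl_left_of_le _ _ (h.trans hi)]
    obtain ⟨i, rfl⟩ : ∃ j, i = Fin.castLE h' j := ⟨⟨i, by omega⟩, rfl⟩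
    rw [incl_left_castLE]
    by_cases hi' : k ≤ i
    · rw [incl_left_of_le _ _ hi', incl_left_of_le _ _ (by simpa using hi')]
    obtain ⟨i, rfl⟩ : ∃ j, i = Fin.castLE h j := ⟨⟨i, by omega⟩, rfl⟩
    rw [incl_left_castLE, Fin.castLE_castLE, incl_left_castLE]
  · by_cases hi : l ≤ i
    · rw [incl_right_of_le _ _ hi, incl_right_of_le _ _ (h.trans hi)]
    obtain ⟨i, rfl⟩ : ∃ j, i = Fin.castLE h' j := ⟨⟨i, by omega⟩, rfl⟩
    rw [incl_right_castLE]
    by_cases hi' : k ≤ i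
    · rw [incl_right_of_le _ _ hi', incl_right_of_le _ _ (by simpa using hi')]
    obtain ⟨i, rfl⟩ : ∃ j, i = Fin.castLE h j := ⟨⟨i, by omega⟩, rfl⟩
    rw [incl_right_castLE, Fin.castLE_castLE, Fin.castLE_castLE, incl_right_castLE]

theorem supp_incl {k n : ℕ} (h : k ≤ n) (g : Wr T k) :
    supp (incl h g) = Fin.castLE h '' supp g := by
  ext i
  by_cases hi : k ≤ i
  · simp only [supp, Set.mem_ofPred_eq, incl_left_of_le h g hi, incl_right_of_le h g hi, ne_eq,
      not_true_eq_false, or_self, false_iff, Set.mem_image, not_exists, not_and]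
    rintro j _ rfl
    exact absurd j.2 (not_lt.2 hi)
  · obtain ⟨j, rfl⟩ : ∃ j, i = Fin.castLE h j := ⟨⟨i, by omega⟩, rfl⟩
    rw [(Fin.castLE_injective h).mem_set_image]
    simp only [supp, Set.mem_ofPred_eq, incl_left_castLE, incl_right_castLE, ne_eq,
      (Fin.castLE_injective h).eq_iff]

theorem ncard_supp_incl {k n : ℕ} (h : k ≤ n) (g : Wr T k) :
    (supp (incl h g)).ncard = (supp g).ncard := by
  rw [supp_incl, Set.ncard_image_of_injective _ (Fin.castLE_injective h)]

/-- The imprimitive action of the wreath product on `Fin n × T`. -/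
def Wr.imprimitive (T : Type*) [Group T] (n : ℕ) : Wr T n →* Equiv.Perm (Fin n × T) :=
  MonoidHom.toHomPerm
    { toFun := fun g p => (g.right p.1, g.left (g.right p.1) * p.2)
      map_one' := by
        funext p
        exact Prod.ext rfl (one_mul _)
      map_mul' := fun g h => by
        funext p
        refine Prod.ext rfl ?_
        change (g * h).left ((g * h).right p.1) * p.2 =
          g.left (g.right (h.right p.1)) * (h.left (h.right p.1) * p.2)
        rw [Wr.mul_right_apply, Wr.mul_left_apply, mul_assoc]
        congr 3
        exact congrArg h.left (g.right.symm_apply_apply _) }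

theorem Wr.imprimitive_apply {n : ℕ} (g : Wr T n) (p : Fin n × T) :
    Wr.imprimitive T n g p = (g.right p.1, g.left (g.right p.1) * p.2) := rfl

theorem Wr.imprimitive_transitive {n : ℕ} (o p : Fin n × T) :
    ∃ g, Wr.imprimitive T n g o = p := by
  refine ⟨⟨fun _ => p.2 * o.2⁻¹, Equiv.swap o.1 p.1⟩, ?_⟩
  rw [Wr.imprimitive_apply]
  exact Prod.ext (Equiv.swap_apply_left _ _) (inv_mul_cancel_right _ _)

/-- T acts freely on itself by left translation, so the second coordinate plays no role; this yields
the fixed-point count |T|(n - |supp g|). -/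
theorem Wr.imprimitive_apply_eq_self_iff {n : ℕ} (g : Wr T n) (p : Fin n × T) :
    Wr.imprimitive T n g p = p ↔ p.1 ∉ supp g := by
  rw [Wr.imprimitive_apply, Prod.ext_iff]
  simp only [supp, Set.mem_ofPred_eq, not_or, ne_eq, not_not, mul_eq_right]
  exact and_congr_right fun h => by rw [h]

/-- Identifies the stabilizer of a point over the last letter with 𝔖_N(T), as
`Irr.sum_mult_mul_character` requires. -/
theorem Wr.last_notMem_supp_iff {N : ℕ} (g : Wr T (N + 1)) :
    Fin.last N ∉ supp g ↔ g ∈ (incl (T := T) (Nat.le_succ N)).range := by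
  constructor
  · intro h
    simp only [supp, Set.mem_ofPred_eq, not_or, ne_eq, not_not] at h
    have hne : ∀ j : Fin N, g.right j.castSucc ≠ Fin.last N := by
      intro j hj
      replace hj := hj.trans h.1.symm
      exact (Fin.castSucc_lt_last j).ne (g.right.injective hj)
    have hinj : Function.Injective fun j : Fin N => (g.right j.castSucc).castPred (hne j) := by
      intro j j' hjj
      have := Fin.castPred_inj.1 hjj
      exact Fin.castSucc_injective _ (g.right.injective this)
    refine ⟨⟨fun j => g.left j.castSucc,
      Equiv.ofBijective _ (Finite.injective_iff_bijective.1 hinj)⟩, ?_⟩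
    refine Wr.ext (fun i => ?_) (fun i => ?_)
    · rcases Fin.eq_castSucc_or_eq_last i with ⟨j, rfl⟩ | rfl
      · exact incl_left_castLE (Nat.le_succ N) _ j
      · rw [h.2]
        exact incl_left_of_le _ _ le_rfl
    · rcases Fin.eq_castSucc_or_eq_last i with ⟨j, rfl⟩ | rfl
      · refine (incl_right_castLE (Nat.le_succ N) _ j).trans ?_
        exact Fin.castSucc_castPred _ (hne j)
      · rw [h.1]
        exact incl_right_of_le _ _ le_rfl
  · rintro ⟨g, rfl⟩
    simp only [supp, Set.mem_ofPred_eq, not_or, ne_eq, not_not]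
    exact ⟨incl_right_of_le _ _ le_rfl, incl_left_of_le _ _ le_rfl⟩

/-- Normalized irreducible characters are eigenfunctions of the Res-Ind chain. -/
theorem sum_resInd_mul_character [Finite T] {n : ℕ} (hn : 1 ≤ n) (lam : Irr (Wr T n))
    (g : Wr T n) :
    ∑ mu : Irr (Wr T n), (resInd n lam mu : ℂ) * (mu.character g / (mu.dim : ℂ)) =
      (1 - ((supp g).ncard : ℂ) / n) * (lam.character g / (lam.dim : ℂ)) := by
  classical
  obtain ⟨N, rfl⟩ : ∃ N, n = N + 1 := ⟨n - 1, by omega⟩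
  have := Fintype.ofFinite T
  have := Fintype.ofFinite (Wr T (N + 1))
  have := Fintype.ofFinite (Wr T N)
  have key := Irr.sum_mult_mul_character (Wr.imprimitive T (N + 1)) (incl (Nat.le_succ N))
    (incl_injective _) (Fin.last N, 1) (Wr.imprimitive_transitive _)
    (fun g => (Wr.imprimitive_apply_eq_self_iff g _).trans (Wr.last_notMem_supp_iff g)) lam g
  have hfix : ∑ x : Fin (N + 1) × T,
      (if Wr.imprimitive T (N + 1) g x = x then (1 : ℂ) else 0) =
        (Nat.card T : ℂ) * (((N + 1 : ℕ) : ℂ) - (supp g).ncard) := by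
    have hs := Set.ncard_add_ncard_compl (supp g)
    rw [Nat.card_fin] at hs
    have hs' : (((N + 1 : ℕ) : ℂ) - (supp g).ncard) = ((supp g)ᶜ).ncard := by
      rw [sub_eq_iff_eq_add', ← Nat.cast_add, hs]
    rw [hs', Set.ncard_eq_toFinset_card', Fintype.sum_prod_type]
    simp only [Wr.imprimitive_apply_eq_self_iff, Finset.sum_const, Finset.card_univ, nsmul_eq_mul,
      Nat.card_eq_fintype_card]
    rw [← Finset.mul_sum, Finset.sum_boole]
    congr 3
    ext i
    simp
  rw [hfix] at key
  have hl : (lam.dim : ℂ) ≠ 0 := by exact_mod_cast lam.dim_ne_zero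
  have hT : (Nat.card T : ℂ) ≠ 0 := by exact_mod_cast Nat.card_pos.ne'
  have hN : ((N + 1 : ℕ) : ℂ) ≠ 0 := by exact_mod_cast Nat.succ_ne_zero N
  -- The factor dim μ in the transition probability cancels the normalization of the character of μ.
  have hterm : ∀ mu : Irr (Wr T (N + 1)),
      (resInd (N + 1) lam mu : ℂ) * (mu.character g / (mu.dim : ℂ)) =
        ((∑ nu : Irr (Wr T N), (Irr.mult (incl (Nat.le_succ N)) nu lam : ℂ) *
          (Irr.mult (incl (Nat.le_succ N)) nu mu : ℂ)) * mu.character g) *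
          (((N + 1 : ℕ) : ℂ) * Nat.card T * lam.dim)⁻¹ := by
    intro mu
    have hm : (mu.dim : ℂ) ≠ 0 := by exact_mod_cast mu.dim_ne_zero
    have h1 : (resInd (N + 1) lam mu : ℂ) =
        (∑ nu : Irr (Wr T N), (Irr.mult (incl (Nat.le_succ N)) nu lam : ℂ) *
          (Irr.mult (incl (Nat.le_succ N)) nu mu : ℂ)) *
          ((mu.dim : ℂ) / (((N + 1 : ℕ) : ℂ) * Nat.card T * lam.dim)) := by
      unfold resInd
      rw [← Finset.sum_mul]
      push_cast
      rfl
    rw [h1]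
    field_simp
  rw [Finset.sum_congr rfl fun mu _ => hterm mu, ← Finset.sum_mul, key]
  field_simp

end WreathAction


/-! ### One-step evolution of the law of the chain. -/

section Chain

variable {Ω : Type*} [MeasurableSpace Ω]

instance Irr.discreteMeasurableSpace (G : Type*) [Group G] : DiscreteMeasurableSpace (Irr G) :=
  ⟨fun _ => trivial⟩

/-- Total probability. Restricting P to A leaves only the fibres of Y to be measured, so A may be
any set. -/
theorem measureReal_eq_sum_inter_fiber {ι : Type*} [Fintype ι] [MeasurableSpace ι]
    [DiscreteMeasurableSpace ι] (P : Measure Ω) [IsFiniteMeasure P] {Y : Ω → ι} (hY : Measurable Y)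
    (A : Set Ω) : P.real A = ∑ y, P.real (A ∩ {ω | Y ω = y}) := by
  have h := measureReal_biUnion_finset (μ := P.restrict A) (s := Finset.univ)
    (f := fun y => {ω | Y ω = y})
    (fun y _ y' _ hne => Set.disjoint_left.2 fun ω hω hω' => hne (hω.symm.trans hω'))
    (fun y _ => hY (MeasurableSet.of_discrete (s := {y})))
  have hu : (⋃ y ∈ (Finset.univ : Finset ι), {ω | Y ω = y}) = Set.univ := by
    ext ω
    simp
  rw [hu, measureReal_restrict_apply_univ] at h
  rw [h]
  refine Finset.sum_congr rfl fun y _ => ?_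
  exact (measureReal_restrict_apply (hY (MeasurableSet.of_discrete (s := {y})))).trans
    (congrArg _ (Set.inter_comm _ _))

variable {T : Type*} [Group T] [Finite T]
  {n : ℕ} {ψ : Measure ℝ} {P : Measure Ω} [IsProbabilityMeasure P]
  {Z : ℕ → Ω → Irr (Wr T n)} {τ : ℕ → Ω → ℝ}

/-- The Markov hypothesis prescribes the whole path from time 0; the early coordinates are forgotten
one at a time by summing over their values. -/
theorem IsResIndDynamics.markov_window (h : IsResIndDynamics n ψ P Z τ) (j a : ℕ) (ha : a ≤ j) :
    ∀ z : ℕ → Irr (Wr T n), P.real {ω | ∀ i, a ≤ i → i ≤ j + 1 → Z i ω = z i} =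
      P.real {ω | ∀ i, a ≤ i → i ≤ j → Z i ω = z i} * resInd n (z j) (z (j + 1)) := by
  classical
  induction a with
  | zero =>
    intro z
    have h1 := h.markov (j + 1) z
    have h2 := h.markov j z
    rw [Finset.prod_range_succ, ← mul_assoc, ← h2] at h1
    simpa using h1
  | succ a ih =>
    intro z
    -- The value y at the forgotten time a varies; the transition factor involves only times j and j
    -- + 1, both later than a.
    have ih' := fun y => ih (by omega) (Function.update z a y)
    have hset : ∀ (l : ℕ), a ≤ l → ∀ y, {ω | ∀ i, a ≤ i → i ≤ l → Z i ω = Function.update z a y i} =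
        {ω | ∀ i, a + 1 ≤ i → i ≤ l → Z i ω = z i} ∩ {ω | Z a ω = y} := by
      intro l hl y
      ext ω
      constructor
      · intro hω
        refine ⟨fun i hi hil => ?_, ?_⟩
        · rw [hω i (by omega) hil, Function.update_of_ne (by omega)]
        · exact (hω a le_rfl hl).trans (Function.update_self ..)
      · rintro ⟨hω, hωa⟩ i hi hil
        rcases hi.eq_or_lt with rfl | hi
        · rw [Function.update_self]
          exact hωa
        · rw [Function.update_of_ne (by omega)]
          exact hω i hi hil
    rw [measureReal_eq_sum_inter_fiber P (h.measurable_chain a),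
      measureReal_eq_sum_inter_fiber P (h.measurable_chain a)
        {ω | ∀ i, a + 1 ≤ i → i ≤ j → Z i ω = z i}, Finset.sum_mul]
    refine Finset.sum_congr rfl fun y _ => ?_
    rw [← hset (j + 1) (by omega), ← hset j (by omega), ih', Function.update_of_ne (by omega),
      Function.update_of_ne (by omega)]

theorem IsResIndDynamics.measureReal_succ (h : IsResIndDynamics n ψ P Z τ) (j : ℕ)
    (mu : Irr (Wr T n)) :
    P.real {ω | Z (j + 1) ω = mu} = ∑ lam, P.real {ω | Z j ω = lam} * resInd n lam mu := by
  classical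
  rw [measureReal_eq_sum_inter_fiber P (h.measurable_chain j)]
  refine Finset.sum_congr rfl fun lam _ => ?_
  -- A window of two letters: `lam` at time j, `mu` at time j + 1.
  have hw := h.markov_window j j le_rfl (fun i => if i = j then lam else mu)
  simp only [if_true, Nat.succ_ne_self, if_false] at hw
  have e1 : {ω | ∀ i, j ≤ i → i ≤ j + 1 → Z i ω = if i = j then lam else mu} =
      {ω | Z (j + 1) ω = mu} ∩ {ω | Z j ω = lam} := by
    ext ω
    constructor
    · intro hω
      exact ⟨by simpa using hω (j + 1) (by omega) le_rfl, by simpa using hω j le_rfl (by omega)⟩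
    · rintro ⟨h1, h2⟩ i hi hi'
      rcases (show i = j ∨ i = j + 1 by omega) with rfl | rfl
      · simpa using h2
      · simpa using h1
  have e2 : {ω | ∀ i, j ≤ i → i ≤ j → Z i ω = if i = j then lam else mu} = {ω | Z j ω = lam} := by
    ext ω
    constructor
    · intro hω
      simpa using hω j le_rfl le_rfl
    · intro h1 i hi hi'
      obtain rfl : i = j := by omega
      simpa using h1
  rw [e1, e2] at hw
  exact hw

theorem IsResIndDynamics.fourier_chain (h : IsResIndDynamics n ψ P Z τ) (hn : 1 ≤ n)
    (g : Wr T n) (j : ℕ) :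
    fourier (fun lam => P.real {ω | Z j ω = lam}) g =
      (1 - ((supp g).ncard : ℂ) / n) ^ j * fourier (fun lam => P.real {ω | Z 0 ω = lam}) g := by
  induction j with
  | zero => simp
  | succ j ih =>
    rw [pow_succ', mul_assoc, ← ih]
    unfold fourier
    simp_rw [h.measureReal_succ j]
    push_cast
    simp_rw [Finset.sum_mul]
    rw [Finset.sum_comm, Finset.mul_sum]
    refine Finset.sum_congr rfl fun lam _ => ?_
    simp_rw [mul_assoc]
    rw [← Finset.mul_sum, sum_resInd_mul_character hn]
    ring

end Chain

/-! ### Separating the clock from the chain, and the strong law for the pausing times. -/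

section Renewal

/-- The counting process on the canonical space of sequences of pausing times. -/
def seqCounting (s : ℝ) (x : ℕ → ℝ) : ℕ := counting (fun j (y : ℕ → ℝ) => y j) s x

theorem measurable_seqCounting (s : ℝ) : Measurable (seqCounting s) := by
  refine measurable_ncard.comp (measurable_set_iff.2 fun j => ?_)
  have h : Measurable fun x : ℕ → ℝ => ∑ i ∈ Finset.range (j + 1), x i := by fun_prop
  exact measurableSet_setOfPred.1 (measurableSet_le h measurable_const)

theorem integral_eq_sum_measureReal_fiber {Ω ι : Type*} [MeasurableSpace Ω] [Fintype ι]
    [MeasurableSpace ι] [DiscreteMeasurableSpace ι] (P : Measure Ω) [IsFiniteMeasure P] {Y : Ω → ι}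
    (hY : Measurable Y) (c : ι → ℂ) :
    ∫ ω, c (Y ω) ∂P = ∑ y, (P.real {ω | Y ω = y} : ℂ) * c y := by
  rw [← integral_map hY.aemeasurable (f := c) (by fun_prop)]
  have : IsFiniteMeasure (P.map Y) := Measure.isFiniteMeasure_map P Y
  rw [integral_fintype (Integrable.of_finite)]
  refine Finset.sum_congr rfl fun y _ => ?_
  rw [map_measureReal_apply hY (MeasurableSet.of_discrete (s := {y}))]
  rfl

variable {T : Type*} [Group T] [Finite T] {Ω : Type*} [MeasurableSpace Ω]
  {n : ℕ} {ψ : Measure ℝ} [IsProbabilityMeasure ψ] {P : Measure Ω} [IsProbabilityMeasure P]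
  {Z : ℕ → Ω → Irr (Wr T n)} {τ : ℕ → Ω → ℝ}

/-- Independence makes the joint law of clock and chain a product. By Fubini the pausing times may
be frozen, and the chain then runs for a deterministic number of steps. -/
theorem IsResIndDynamics.fourier_lawAt (h : IsResIndDynamics n ψ P Z τ) (hn : 1 ≤ n)
    (g : Wr T n) (s : ℝ) :
    fourier (lawAt P Z τ s) g =
      (∫ x, (1 - ((supp g).ncard : ℂ) / n) ^ seqCounting s x ∂Measure.infinitePi (fun _ : ℕ => ψ)) *
        fourier (fun lam => P.real {ω | Z 0 ω = lam}) g := by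
  let c : Irr (Wr T n) → ℂ := fun lam => lam.character g / (lam.dim : ℂ)
  have hZ : Measurable fun ω (j : ℕ) => Z j ω := measurable_pi_lambda _ h.measurable_chain
  have hτ : Measurable fun ω (j : ℕ) => τ j ω := measurable_pi_lambda _ h.measurable_pausing
  have hlaw : P.map (fun ω (j : ℕ) => τ j ω) = Measure.infinitePi (fun _ : ℕ => ψ) := by
    rw [h.iid_pausing.map_fun_eq_infinitePi_map h.measurable_pausing]
    simp_rw [h.law_pausing]
  let F : (ℕ → ℝ) × (ℕ → Irr (Wr T n)) → Irr (Wr T n) := fun p => p.2 (seqCounting s p.1)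
  have hF : Measurable F := by
    -- Evaluating at a random index is jointly measurable because the index set is countable.
    have h1 : Measurable fun q : (ℕ → Irr (Wr T n)) × ℕ => q.1 q.2 :=
      measurable_from_prod_countable_left fun j =>
        measurable_pi_apply (X := fun _ : ℕ => Irr (Wr T n)) j
    exact h1.comp (measurable_snd.prodMk ((measurable_seqCounting s).comp measurable_fst))
  have hpair : P.map (fun ω => ((fun j => τ j ω), (fun j => Z j ω))) =
      (Measure.infinitePi (fun _ : ℕ => ψ)).prod (P.map fun ω (j : ℕ) => Z j ω) := by
    rw [← hlaw]
    exact (indepFun_iff_map_prod_eq_prod_map_map hτ.aemeasurable hZ.aemeasurable).1 h.indep.symm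
  have hmeas : Measurable fun ω => Z (counting τ s ω) ω := hF.comp (hτ.prodMk hZ)
  have : IsProbabilityMeasure (P.map fun ω (j : ℕ) => Z j ω) :=
    Measure.isProbabilityMeasure_map hZ.aemeasurable
  have hcF : Measurable fun p => c (F p) := (Measurable.of_discrete (f := c)).comp hF
  have hint : Integrable (fun p => c (F p))
      ((Measure.infinitePi (fun _ : ℕ => ψ)).prod (P.map fun ω (j : ℕ) => Z j ω)) := by
    obtain ⟨C, hC⟩ := (Set.finite_range fun lam => ‖c lam‖).bddAbove
    exact Integrable.of_bound hcF.aestronglyMeasurable C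
      (Eventually.of_forall fun p => hC ⟨_, rfl⟩)
  calc fourier (lawAt P Z τ s) g = ∫ ω, c (Z (counting τ s ω) ω) ∂P :=
        (integral_eq_sum_measureReal_fiber P hmeas c).symm
    _ = ∫ p, c (F p) ∂(P.map (fun ω => ((fun j => τ j ω), (fun j => Z j ω)))) :=
        (integral_map (hτ.prodMk hZ).aemeasurable hcF.aestronglyMeasurable).symm
    _ = ∫ x, ∫ z, c (F (x, z)) ∂(P.map fun ω (j : ℕ) => Z j ω)
          ∂Measure.infinitePi (fun _ : ℕ => ψ) := by
        rw [hpair, integral_prod _ hint]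
    _ = ∫ x, (1 - ((supp g).ncard : ℂ) / n) ^ seqCounting s x *
          fourier (fun lam => P.real {ω | Z 0 ω = lam}) g
            ∂Measure.infinitePi (fun _ : ℕ => ψ) := by
        refine integral_congr_ae (Eventually.of_forall fun x => ?_)
        change ∫ z, c (z (seqCounting s x)) ∂(P.map fun ω (j : ℕ) => Z j ω) = _
        refine (integral_map (f := fun z : ℕ → Irr (Wr T n) => c (z (seqCounting s x)))
          hZ.aemeasurable ((Measurable.of_discrete (f := c)).comp
            (measurable_pi_apply (X := fun _ : ℕ => Irr (Wr T n)) _)).aestronglyMeasurable).trans ?_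
        rw [integral_eq_sum_measureReal_fiber P (h.measurable_chain _) c]
        exact h.fourier_chain hn g _
    _ = _ := integral_mul_const _ _

theorem ae_pos_infinitePi (hψpos : ψ (Set.Iic 0) = 0) :
    ∀ᵐ x ∂Measure.infinitePi (fun _ : ℕ => ψ), ∀ j, 0 < x j := by
  rw [ae_all_iff]
  intro j
  have hp := measurePreserving_eval_infinitePi (fun _ : ℕ => ψ) j
  have h0 : ∀ᵐ y ∂ψ, 0 < y := by
    rw [ae_iff]
    simpa [Set.Iic] using hψpos
  exact hp.quasiMeasurePreserving.ae h0

/-- The spaces `Ω n` vary with n. Working on the one canonical space of sequences gives almost sure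
convergence along n a meaning. -/
theorem ae_tendsto_partial_sum_div (hψint : Integrable (fun x : ℝ => x) ψ) :
    ∀ᵐ x ∂Measure.infinitePi (fun _ : ℕ => ψ),
      Tendsto (fun n : ℕ => (∑ i ∈ Finset.range n, x i) / (n : ℝ)) atTop (𝓝 (∫ y, y ∂ψ)) := by
  have hp := fun j => measurePreserving_eval_infinitePi (fun _ : ℕ => ψ) j
  have hind : iIndepFun (fun (j : ℕ) (x : ℕ → ℝ) => x j) (Measure.infinitePi (fun _ : ℕ => ψ)) :=
    iIndepFun_infinitePi (X := fun _ x => x) (fun _ => measurable_id)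
  have hm : ∫ x : ℕ → ℝ, x 0 ∂Measure.infinitePi (fun _ : ℕ => ψ) = ∫ y, y ∂ψ := by
    conv_rhs => rw [← (hp 0).map_eq]
    exact (integral_map (f := fun y : ℝ => y)
      (measurable_pi_apply (X := fun _ : ℕ => ℝ) 0).aemeasurable
      measurable_id.aestronglyMeasurable).symm
  rw [← hm]
  refine strong_law_ae_real (fun (j : ℕ) (x : ℕ → ℝ) => x j)
    ((hp 0).integrable_comp_of_integrable hψint) (fun i j hij => hind.indepFun hij) fun i => ?_
  exact ⟨(measurable_pi_apply (X := fun _ : ℕ => ℝ) i).aemeasurable,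
    (measurable_pi_apply (X := fun _ : ℕ => ℝ) 0).aemeasurable, (hp i).map_eq.trans (hp 0).map_eq.symm⟩

theorem integral_pos_of_measure_Iic_eq_zero (hψpos : ψ (Set.Iic 0) = 0)
    (hψint : Integrable (fun x : ℝ => x) ψ) : 0 < ∫ y, y ∂ψ := by
  have h0 : ∀ᵐ y ∂ψ, 0 < y := by
    rw [ae_iff]
    simpa [Set.Iic] using hψpos
  rw [integral_pos_iff_support_of_nonneg_ae (h0.mono fun y hy => hy.le) hψint]
  have : ψ (Function.support fun y : ℝ => y) = 1 := by
    rw [prob_compl_eq_zero_iff₀ (by measurability) |>.1]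
    exact measure_mono_null (fun y hy => by simpa using le_of_eq (by simpa using hy)) hψpos
  rw [this]
  exact one_pos

end Renewal

/-! ### Pathwise asymptotics of the counting process. -/

section Deterministic

variable {x : ℕ → ℝ}

/-- The partial sums increase strictly to infinity, so the counted set is a finite initial segment;
in particular `Set.ncard` does not return its default value 0 for an infinite set. -/
theorem setOf_partial_sum_le_eq_Iio (hx : ∀ j, 0 < x j) {m : ℝ} (hm : 0 < m)
    (hlim : Tendsto (fun n : ℕ => (∑ i ∈ Finset.range n, x i) / (n : ℝ)) atTop (𝓝 m)) (s : ℝ) :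
    {j : ℕ | ∑ i ∈ Finset.range (j + 1), x i ≤ s} = Set.Iio (seqCounting s x) := by
  have hmono : StrictMono fun n => ∑ i ∈ Finset.range n, x i :=
    strictMono_nat_of_lt_succ fun n => by
      rw [Finset.sum_range_succ]
      linarith [hx n]
  have htop : Tendsto (fun n : ℕ => ∑ i ∈ Finset.range n, x i) atTop atTop := by
    refine (hlim.pos_mul_atTop hm tendsto_natCast_atTop_atTop).congr' ?_
    filter_upwards [eventually_gt_atTop 0] with n hn
    have : (n : ℝ) ≠ 0 := by positivity
    field_simp
  obtain ⟨K, hK⟩ := (htop.eventually_gt_atTop s).exists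
  have hex : ∃ k, s < ∑ i ∈ Finset.range (k + 1), x i :=
    ⟨K, hK.trans (hmono (Nat.lt_succ_self K))⟩
  classical
  have hset : {j : ℕ | ∑ i ∈ Finset.range (j + 1), x i ≤ s} = Set.Iio (Nat.find hex) := by
    ext j
    simp only [Set.mem_ofPred_eq, Set.mem_Iio]
    constructor
    · intro hj
      by_contra! hcon
      have h1 := Nat.find_spec hex
      have h2 := hmono.monotone (Nat.succ_le_succ hcon)
      exact absurd (h1.trans_le h2) (not_lt.2 hj)
    · intro hj
      exact not_lt.1 (Nat.find_min hex hj)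
  have hcard : seqCounting s x = Nat.find hex := by
    change Set.ncard {j : ℕ | ∑ i ∈ Finset.range (j + 1), x i ≤ s} = _
    rw [hset, Set.ncard_eq_toFinset_card']
    simp
  rw [hcard, hset]

theorem seqCounting_zero (hx : ∀ j, 0 < x j) : seqCounting 0 x = 0 := by
  change Set.ncard {j : ℕ | ∑ i ∈ Finset.range (j + 1), x i ≤ 0} = 0
  have : {j : ℕ | ∑ i ∈ Finset.range (j + 1), x i ≤ 0} = ∅ := by
    ext j
    simp only [Set.mem_ofPred_eq, Set.mem_empty_iff_false, iff_false, not_le]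
    exact Finset.sum_pos (fun i _ => hx i) (by simp)
  rw [this, Set.ncard_empty]

/-- Renewal sandwich: S_N ≤ tn < S_{N+1}. Dividing by N, both ends tend to m, so tn/N → m. -/
theorem tendsto_seqCounting_div (hx : ∀ j, 0 < x j) {m : ℝ} (hm : 0 < m)
    (hlim : Tendsto (fun n : ℕ => (∑ i ∈ Finset.range n, x i) / (n : ℝ)) atTop (𝓝 m)) {t : ℝ}
    (ht : 0 < t) :
    Tendsto (fun n : ℕ => (seqCounting (t * n) x : ℝ) / n) atTop (𝓝 (t / m)) := by
  set S : ℕ → ℝ := fun k => ∑ i ∈ Finset.range k, x i with hS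
  let N : ℕ → ℕ := fun n => seqCounting (t * n) x
  have hset : ∀ n j : ℕ, S (j + 1) ≤ t * n ↔ j < N n := fun n j =>
    Set.ext_iff.1 (setOf_partial_sum_le_eq_Iio hx hm hlim (t * n)) j
  have hub : ∀ n : ℕ, t * n < S (N n + 1) := fun n => not_le.1 fun h => lt_irrefl _ ((hset n _).1 h)
  have hlb : ∀ n : ℕ, S (N n) ≤ t * n := by
    intro n
    rcases Nat.eq_zero_or_pos (N n) with h | h
    · rw [h, hS]
      simp only [Finset.range_zero, Finset.sum_empty]
      positivity
    · have := (hset n (N n - 1)).2 (by omega)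
      rwa [Nat.sub_add_cancel h] at this
  have htn : Tendsto (fun n : ℕ => t * (n : ℝ)) atTop atTop :=
    tendsto_natCast_atTop_atTop.const_mul_atTop ht
  have hN : Tendsto N atTop atTop := by
    rw [tendsto_atTop]
    intro K
    filter_upwards [htn.eventually_ge_atTop (S (K + 1))] with n hn
    exact ((hset n K).1 hn).le
  have h1 : Tendsto (fun n => S (N n) / (N n : ℝ)) atTop (𝓝 m) := hlim.comp hN
  -- The upper end S_{N+1}/N, written so that the law of large numbers applies at index N + 1.
  have h2 : Tendsto (fun n => S (N n + 1) / ((N n + 1 : ℕ) : ℝ) * (1 + 1 / (N n : ℝ)))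
      atTop (𝓝 m) := by
    have h3 : Tendsto (fun n => S (N n + 1) / ((N n + 1 : ℕ) : ℝ)) atTop (𝓝 m) :=
      hlim.comp ((tendsto_add_atTop_nat 1).comp hN)
    have h4 : Tendsto (fun n => 1 + 1 / (N n : ℝ)) atTop (𝓝 (1 + 0)) :=
      tendsto_const_nhds.add (tendsto_one_div_atTop_nhds_zero_nat.comp hN)
    simpa using h3.mul h4
  have h5 : Tendsto (fun n : ℕ => t * n / (N n : ℝ)) atTop (𝓝 m) := by
    refine tendsto_of_tendsto_of_tendsto_of_le_of_le' h1 h2 ?_ ?_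
    · exact Eventually.of_forall fun n => div_le_div_of_nonneg_right (hlb n) (Nat.cast_nonneg _)
    · filter_upwards [hN.eventually_gt_atTop 0] with n hn
      have hn' : (0 : ℝ) < N n := by exact_mod_cast hn
      have e : S (N n + 1) / ((N n + 1 : ℕ) : ℝ) * (1 + 1 / (N n : ℝ)) = S (N n + 1) / N n := by
        push_cast
        field_simp
      rw [e]
      exact div_le_div_of_nonneg_right (hub n).le hn'.le
  have h6 := (h5.inv₀ hm.ne').const_mul t
  rw [div_eq_mul_inv]
  refine h6.congr' ?_
  filter_upwards [eventually_gt_atTop 0] with n hn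
  have hn' : (0 : ℝ) < n := by exact_mod_cast hn
  change t * (t * n / (N n : ℝ))⁻¹ = (N n : ℝ) / n
  field_simp

/-- Take logarithms: n log(1 - a/n) → -a, and this is multiplied by N/n → c. -/
theorem tendsto_one_sub_div_pow {N : ℕ → ℕ} {c : ℝ} (a : ℝ)
    (hN : Tendsto (fun n : ℕ => (N n : ℝ) / n) atTop (𝓝 c)) :
    Tendsto (fun n : ℕ => (1 - a / n) ^ N n) atTop (𝓝 (Real.exp (-(a * c)))) := by
  have h1 : Tendsto (fun n : ℕ => (n : ℝ) * Real.log (1 + (-a) / n)) atTop (𝓝 (-a)) :=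
    (Real.tendsto_mul_log_one_add_div_atTop (-a)).comp tendsto_natCast_atTop_atTop
  have h2 := (Real.continuous_exp.tendsto _).comp (h1.mul hN)
  rw [neg_mul] at h2
  refine h2.congr' ?_
  have h3 : Tendsto (fun n : ℕ => 1 - a / (n : ℝ)) atTop (𝓝 (1 - 0)) :=
    tendsto_const_nhds.sub (tendsto_natCast_atTop_atTop.const_div_atTop a)
  rw [sub_zero] at h3
  filter_upwards [h3.eventually_const_lt zero_lt_one, eventually_gt_atTop 0] with n hpos hn
  have hn' : (0 : ℝ) < n := by exact_mod_cast hn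
  change Real.exp ((n : ℝ) * Real.log (1 + (-a) / n) * ((N n : ℝ) / n)) = _
  rw [neg_div, ← sub_eq_add_neg, ← Real.exp_log hpos, Real.log_exp, ← Real.exp_nat_mul]
  congr 1
  field_simp

end Deterministic

/-! ### Limit of the averaged factor. -/

section Limit

variable {ψ : Measure ℝ} [IsProbabilityMeasure ψ]

theorem norm_one_sub_div_pow_le {a n : ℕ} (h : a ≤ n) (j : ℕ) :
    ‖(1 - (a : ℂ) / n) ^ j‖ ≤ 1 := by
  rw [norm_pow]
  refine pow_le_one₀ (norm_nonneg _) ?_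
  have e : (1 - (a : ℂ) / n) = ((1 - (a : ℝ) / n : ℝ) : ℂ) := by push_cast; rfl
  rw [e, Complex.norm_real, Real.norm_eq_abs, abs_le]
  have h1 : (a : ℝ) / n ≤ 1 := div_le_one_of_le₀ (by exact_mod_cast h) (Nat.cast_nonneg _)
  have h2 : 0 ≤ (a : ℝ) / n := by positivity
  constructor <;> linarith

/-- Dominated convergence with bound 1, available once n ≥ a puts the base in [0, 1]. -/
theorem tendsto_integral_one_sub_div_pow (hψpos : ψ (Set.Iic 0) = 0)
    (hψint : Integrable (fun x : ℝ => x) ψ) {t : ℝ} (ht : 0 < t) (a : ℕ) :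
    Tendsto (fun n : ℕ => ∫ x, (1 - (a : ℂ) / n) ^ seqCounting (t * n) x
      ∂Measure.infinitePi (fun _ : ℕ => ψ)) atTop
      (𝓝 (Complex.exp (-((a : ℂ) * ((t / ∫ y, y ∂ψ : ℝ) : ℂ))))) := by
  have hm := integral_pos_of_measure_Iic_eq_zero hψpos hψint
  have hlim : ∫ _x : ℕ → ℝ, Complex.exp (-((a : ℂ) * ((t / ∫ y, y ∂ψ : ℝ) : ℂ)))
      ∂Measure.infinitePi (fun _ : ℕ => ψ) =
      Complex.exp (-((a : ℂ) * ((t / ∫ y, y ∂ψ : ℝ) : ℂ))) := by simp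
  rw [← hlim]
  refine tendsto_integral_filter_of_dominated_convergence (fun _ => 1) ?_ ?_
    (integrable_const _) ?_
  · refine Eventually.of_forall fun n => ?_
    exact ((Measurable.of_discrete (f := fun j : ℕ => (1 - (a : ℂ) / n) ^ j)).comp
      (measurable_seqCounting _)).aestronglyMeasurable
  · filter_upwards [eventually_ge_atTop a] with n hn
    exact Eventually.of_forall fun x => norm_one_sub_div_pow_le hn _
  · filter_upwards [ae_pos_infinitePi hψpos, ae_tendsto_partial_sum_div hψint] with x hx hxlim
    have h := tendsto_one_sub_div_pow (a : ℝ) (tendsto_seqCounting_div hx hm hxlim ht)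
    have h' := (Complex.continuous_ofReal.tendsto _).comp h
    simpa [Function.comp_def] using h'

end Limit


/-! ### The exponent |type g| - l(type g) as a sum over letters. -/

section Defect

/-- The number of letters minus the number of cycles, as a sum over the letters. -/
def defect {k : ℕ} (σ : Equiv.Perm (Fin k)) : ℝ :=
  ∑ i, (1 - 1 / (Function.minimalPeriod σ i : ℝ))

theorem card_sameCycle {k : ℕ} (σ : Equiv.Perm (Fin k)) (i : Fin k) :
    Nat.card {j // σ.SameCycle i j} = Function.minimalPeriod σ i := by
  classical
  have h := MulAction.minimalPeriod_eq_card (a := σ) (b := i)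
  rw [← Nat.card_eq_fintype_card] at h
  refine Eq.trans (Nat.card_congr (Equiv.subtypeEquivRight fun j => ?_)) h.symm
  constructor
  · rintro ⟨m, hm⟩
    exact ⟨⟨σ ^ m, m, rfl⟩, hm⟩
  · rintro ⟨⟨_, m, rfl⟩, hm⟩
    exact ⟨m, hm⟩

theorem minimalPeriod_perm_pos {k : ℕ} (σ : Equiv.Perm (Fin k)) (i : Fin k) :
    0 < Function.minimalPeriod σ i :=
  Function.minimalPeriod_pos_of_mem_periodicPts (σ.injective.mem_periodicPts i)

theorem minimalPeriod_eq_of_sameCycle {k : ℕ} {σ : Equiv.Perm (Fin k)} {i j : Fin k}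
    (h : σ.SameCycle i j) : Function.minimalPeriod σ j = Function.minimalPeriod σ i := by
  rw [← card_sameCycle, ← card_sameCycle]
  exact Nat.card_congr (Equiv.subtypeEquivRight fun l => ⟨h.trans, h.symm.trans⟩)

/-- A cycle of length p has p letters, each contributing 1 - 1/p. -/
theorem sum_sameCycle {k : ℕ} (σ : Equiv.Perm (Fin k)) (i : Fin k)
    [DecidablePred (σ.SameCycle i)] :
    ∑ j with σ.SameCycle i j, (1 - 1 / (Function.minimalPeriod σ j : ℝ)) =
      (Function.minimalPeriod σ i : ℝ) - 1 := by
  have hp : (Function.minimalPeriod σ i : ℝ) ≠ 0 := by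
    exact_mod_cast (minimalPeriod_perm_pos σ i).ne'
  have hc : (Finset.univ.filter (σ.SameCycle i)).card = Function.minimalPeriod σ i := by
    rw [← card_sameCycle, Nat.card_eq_fintype_card, Fintype.card_subtype]
  rw [Finset.sum_congr rfl (g := fun _ => 1 - 1 / (Function.minimalPeriod σ i : ℝ))
    fun j hj => by rw [minimalPeriod_eq_of_sameCycle (Finset.mem_filter.1 hj).2],
    Finset.sum_const, hc, nsmul_eq_mul]
  field_simp

variable {T : Type*} [Group T]

theorem size_sub_length_eq_sum (r : Multiset (ConjClasses T × ℕ)) :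
    (size r : ℝ) - length r = (r.map fun p => (p.2 : ℝ) - 1).sum := by
  induction r using Multiset.induction with
  | empty => simp [size, length]
  | cons a s ih =>
    simp only [size, length, Multiset.map_cons, Multiset.sum_cons, Multiset.card_cons] at ih ⊢
    rw [← ih]
    push_cast
    ring

/-- Rows of length 1 contribute p - 1 = 0, so dropping the trivial ones changes nothing; the rest is
grouping letters by cycle. The letterwise form makes the exponent visibly additive when g is cut
along an invariant set. -/
theorem size_sub_length_redType {k : ℕ} (g : Wr T k) :
    (size (redType g) : ℝ) - length (redType g) = defect g.right := by
  classical
  have hdrop : ((redType g).map fun p => (p.2 : ℝ) - 1).sum =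
      ((fullType g).map fun p => (p.2 : ℝ) - 1).sum := by
    conv_rhs => rw [← Multiset.filter_add_not (fun r => r ≠ (ConjClasses.mk 1, 1)) (fullType g)]
    rw [Multiset.map_add, Multiset.sum_add, redType, left_eq_add]
    refine Multiset.sum_eq_zero fun x hx => ?_
    obtain ⟨p, hp, rfl⟩ := Multiset.mem_map.1 hx
    rw [not_not.1 (Multiset.mem_filter.1 hp).2]
    simp
  rw [size_sub_length_eq_sum, hdrop, fullType, Multiset.map_map]
  let _ := Fintype.ofFinite (Quotient (Equiv.Perm.SameCycle.setoid g.right))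
  rw [defect, ← Finset.sum_fiberwise (g := fun i : Fin k =>
    (Quotient.mk (Equiv.Perm.SameCycle.setoid g.right) i))]
  refine Finset.sum_congr rfl fun q _ => ?_
  induction q using Quotient.inductionOn with
  | h i =>
    have e : (Finset.univ.filter fun j : Fin k =>
        (Quotient.mk (Equiv.Perm.SameCycle.setoid g.right) j) =
          Quotient.mk (Equiv.Perm.SameCycle.setoid g.right) i) =
        Finset.univ.filter (g.right.SameCycle i) := by
      ext j
      simp only [Finset.mem_filter, Finset.mem_univ, true_and]
      exact ⟨fun h => (Quotient.exact h).symm, fun h => Quotient.sound h.symm⟩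
    rw [e, sum_sameCycle]
    rfl

end Defect

/-! ### Cutting an element along an invariant set of letters. -/

section Restrict

variable {T : Type*} [Group T]

open Classical in
/-- The part of `g` on a set of letters invariant under its permutation. -/
def Wr.restrict {k : ℕ} (g : Wr T k) (S : Set (Fin k)) (hS : ∀ j, g.right j ∈ S ↔ j ∈ S) :
    Wr T k :=
  ⟨fun j => if j ∈ S then g.left j else 1,
    Equiv.Perm.ofSubtype (g.right.subtypePerm (p := (· ∈ S)) fun j => hS j)⟩

variable {k : ℕ} (g : Wr T k) (S : Set (Fin k)) (hS : ∀ j, g.right j ∈ S ↔ j ∈ S)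

theorem Wr.restrict_left_of_mem {j : Fin k} (hj : j ∈ S) : (g.restrict S hS).left j = g.left j :=
  if_pos hj

theorem Wr.restrict_left_of_notMem {j : Fin k} (hj : j ∉ S) : (g.restrict S hS).left j = 1 :=
  if_neg hj

theorem Wr.restrict_right_of_mem {j : Fin k} (hj : j ∈ S) :
    (g.restrict S hS).right j = g.right j := by
  classical
  exact Equiv.Perm.ofSubtype_apply_of_mem (p := (· ∈ S)) _ hj

theorem Wr.restrict_right_of_notMem {j : Fin k} (hj : j ∉ S) :
    (g.restrict S hS).right j = j := by
  classical
  exact Equiv.Perm.ofSubtype_apply_of_not_mem (p := (· ∈ S)) _ hj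

theorem Wr.supp_restrict : supp (g.restrict S hS) = supp g ∩ S := by
  ext j
  by_cases hj : j ∈ S
  · simp [supp, Wr.restrict_left_of_mem, Wr.restrict_right_of_mem, hj]
  · simp [supp, Wr.restrict_left_of_notMem, Wr.restrict_right_of_notMem, hj]

theorem Wr.restrict_mul_restrict_compl (hS' : ∀ j, g.right j ∈ Sᶜ ↔ j ∈ Sᶜ) :
    g.restrict S hS * g.restrict Sᶜ hS' = g := by
  refine Wr.ext (fun j => ?_) (fun j => ?_)
  · rw [Wr.mul_left_apply]
    by_cases hj : j ∈ S
    · have h1 : (g.restrict S hS).right⁻¹ j ∈ S := by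
        by_contra hcon
        have h2 := g.restrict_right_of_notMem S hS hcon
        rw [show (g.restrict S hS).right ((g.restrict S hS).right⁻¹ j) = j from
          Equiv.apply_symm_apply _ _] at h2
        exact hcon (h2 ▸ hj)
      rw [g.restrict_left_of_mem S hS hj, g.restrict_left_of_notMem Sᶜ hS' (by simpa using h1),
        mul_one]
    · rw [g.restrict_left_of_notMem S hS hj, one_mul, Equiv.Perm.inv_eq_iff_eq.2
        (g.restrict_right_of_notMem S hS hj).symm, g.restrict_left_of_mem Sᶜ hS' hj]
  · rw [Wr.mul_right_apply]
    by_cases hj : j ∈ S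
    · rw [g.restrict_right_of_notMem Sᶜ hS' (by simpa using hj), g.restrict_right_of_mem S hS hj]
    · rw [g.restrict_right_of_mem Sᶜ hS' hj, g.restrict_right_of_notMem S hS (by rwa [hS])]

open Classical in
-- Orbits inside S are unchanged, and letters outside S become fixed, hence contribute 1 - 1/1 = 0.
theorem Wr.defect_restrict : defect (g.restrict S hS).right =
    ∑ j, if j ∈ S then (1 - 1 / (Function.minimalPeriod g.right j : ℝ)) else 0 := by
  refine Finset.sum_congr rfl fun j _ => ?_
  split_ifs with hj
  · have hit : ∀ m : ℕ, (g.restrict S hS).right^[m] j = g.right^[m] j ∧ g.right^[m] j ∈ S := by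
      intro m
      induction m with
      | zero => exact ⟨rfl, hj⟩
      | succ m ih =>
        rw [Function.iterate_succ_apply', Function.iterate_succ_apply', ih.1,
          g.restrict_right_of_mem S hS ih.2]
        exact ⟨rfl, (hS _).2 ih.2⟩
    have : Function.minimalPeriod (g.restrict S hS).right j = Function.minimalPeriod g.right j := by
      rw [Function.minimalPeriod_eq_minimalPeriod_iff]
      intro m
      simp only [Function.IsPeriodicPt, Function.IsFixedPt, (hit m).1]
    rw [this]
  · have : Function.minimalPeriod (g.restrict S hS).right j = 1 :=
      Function.minimalPeriod_eq_one_iff_isFixedPt.2 (g.restrict_right_of_notMem S hS hj)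
    rw [this]
    simp

theorem Wr.supp_mul {g h : Wr T k} (hd : Disjoint (supp g) (supp h)) :
    supp (g * h) = supp g ∪ supp h := by
  have hfix : ∀ {u : Wr T k} {j}, j ∉ supp u → u.right j = j ∧ u.left j = 1 := by
    intro u j hj
    simpa [supp, not_or] using hj
  ext j
  rw [Set.mem_union]
  by_cases hg : j ∈ supp g
  · have hh := hfix (Set.disjoint_left.1 hd hg)
    refine iff_of_true ?_ (Or.inl hg)
    by_cases hgj : g.right j = j
    · right
      rw [Wr.mul_left_apply, Equiv.Perm.inv_eq_iff_eq.2 hgj.symm, hh.2, mul_one]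
      exact hg.resolve_left (not_not.2 hgj)
    · left
      rw [Wr.mul_right_apply, hh.1]
      exact hgj
  · have hgj := hfix hg
    simp only [hg, false_or]
    have e1 : (g * h).left j = h.left j := by
      rw [Wr.mul_left_apply, Equiv.Perm.inv_eq_iff_eq.2 hgj.1.symm, hgj.2, one_mul]
    have e2 : (g * h).right j = h.right j := by
      rw [Wr.mul_right_apply]
      by_cases hhj : h.right j = j
      · rw [hhj, hgj.1]
      -- A letter moved by h lands again in the support of h, where g acts trivially.
      · have : h.right j ∈ supp h := Or.inl fun hcon => hhj (h.right.injective hcon)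
        exact (hfix (Set.disjoint_right.1 hd this)).1
    simp only [supp, Set.mem_ofPred_eq, e1, e2]

end Restrict

/-! ### Moving one cycle onto the first letters by conjugation. -/

section SingleCycle

variable {T : Type*} [Group T]

theorem fullType_of_transitive {q : ℕ} (c : Wr T (q + 1)) (h : ∀ j, c.right.SameCycle 0 j) :
    fullType c = {cycleLabel c 0} := by
  have hs : Subsingleton (Quotient (Equiv.Perm.SameCycle.setoid c.right)) := by
    constructor
    intro a b
    induction a, b using Quotient.inductionOn₂ with
    | h a b => exact Quotient.sound ((h a).symm.trans (h b))
  unfold fullType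
  let _ := Fintype.ofFinite (Quotient (Equiv.Perm.SameCycle.setoid c.right))
  rw [show (Finset.univ : Finset (Quotient (Equiv.Perm.SameCycle.setoid c.right))) =
    {Quotient.mk _ 0} from Finset.eq_singleton_iff_unique_mem.2
      ⟨Finset.mem_univ _, fun _ _ => Subsingleton.elim _ _⟩]
  rfl

/-- The part of `g` on one cycle of length `p` is conjugate to an element of `𝔖_p(T)` whose
permutation is a single cycle. -/
theorem exists_conj_restrict_sameCycle {k : ℕ} (g : Wr T k) (i : Fin k)
    (hS : ∀ j, g.right j ∈ {j | g.right.SameCycle i j} ↔ j ∈ {j | g.right.SameCycle i j}) :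
    ∃ (h : cycleLength g i ≤ k) (c : Wr T (cycleLength g i)) (d : Wr T k) (θ : ConjClasses T),
      fullType c = {(θ, cycleLength g i)} ∧
        g.restrict {j | g.right.SameCycle i j} hS = d * incl h c * d⁻¹ := by
  classical
  have hpos : 0 < cycleLength g i := minimalPeriod_perm_pos g.right i
  obtain ⟨q, hq⟩ : ∃ q, cycleLength g i = q + 1 := ⟨cycleLength g i - 1, by omega⟩
  have hper : Function.minimalPeriod g.right i = q + 1 := hq
  rw [hq]
  -- Lists the cycle as i, τ(i), τ²(i), …, which turns τ into the rotation j ↦ j + 1.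
  let e : Fin (q + 1) → Fin k := fun j => g.right^[j] i
  have he : Function.Injective e := by
    intro a b hab
    refine Fin.ext (Function.iterate_injOn_Iio_minimalPeriod (f := g.right) (x := i) ?_ ?_ hab)
    · exact lt_of_lt_of_eq a.2 hper.symm
    · exact lt_of_lt_of_eq b.2 hper.symm
  have hle : q + 1 ≤ k := by simpa using Fintype.card_le_of_injective e he
  have her : ∀ m : ℕ, ∃ j, e j = g.right^[m] i := by
    intro m
    refine ⟨⟨m % (q + 1), Nat.mod_lt _ (Nat.succ_pos q)⟩, ?_⟩
    change g.right^[m % (q + 1)] i = _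
    rw [← hper, Function.iterate_mod_minimalPeriod_eq]
  have hrange : ∀ l, g.right.SameCycle i l ↔ ∃ j, e j = l := by
    intro l
    constructor
    · intro hl
      obtain ⟨m, hm⟩ := hl.exists_nat_pow_eq
      obtain ⟨j, hj⟩ := her m
      exact ⟨j, by rw [hj, ← hm, Equiv.Perm.coe_pow]⟩
    · rintro ⟨j, rfl⟩
      exact ⟨(j : ℕ), by rw [zpow_natCast, Equiv.Perm.coe_pow]⟩
  have hstep : ∀ j, e (finRotate (q + 1) j) = g.right (e j) := by
    intro j
    change g.right^[(finRotate (q + 1) j : Fin (q + 1))] i = g.right (g.right^[j] i)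
    rw [← Function.iterate_succ_apply' g.right, finRotate_apply,
      ← Function.iterate_mod_minimalPeriod_eq (n := (j : ℕ).succ), hper]
    congr 2
    rw [Fin.val_add, Fin.val_one', Nat.add_mod_mod]
  let c : Wr T (q + 1) := ⟨fun j => g.left (e j), finRotate (q + 1)⟩
  have hpow : ∀ m : ℕ, e (c.right^[m] 0) = g.right^[m] i := by
    intro m
    induction m with
    | zero => rfl
    | succ m ih => rw [Function.iterate_succ_apply', Function.iterate_succ_apply', ← ih]; exact hstep _
  have htrans : ∀ j, c.right.SameCycle 0 j := fun j =>
    ⟨(j : ℕ), by rw [zpow_natCast, Equiv.Perm.coe_pow]; exact he (hpow j)⟩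
  have hlen : cycleLength c 0 = q + 1 := by
    refine Eq.trans (Function.minimalPeriod_eq_minimalPeriod_iff.2 fun m => ?_) hper
    constructor
    · intro h
      have := hpow m
      rw [show c.right^[m] 0 = 0 from h] at this
      exact this.symm
    · intro h
      exact he ((hpow m).trans h)
  -- A bijection from the first q + 1 letters to the cycle; any extension σ to all of `Fin k` serves
  -- as the conjugator.
  let E : {x : Fin k // x ∈ Set.range (Fin.castLE hle)} ≃ {x : Fin k // x ∈ Set.range e} :=
    (Equiv.ofInjective _ (Fin.castLE_injective hle)).symm.trans (Equiv.ofInjective e he)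
  let σ : Equiv.Perm (Fin k) := E.extendSubtype
  have hσ : ∀ j, σ (Fin.castLE hle j) = e j := by
    intro j
    refine (Equiv.extendSubtype_apply_of_mem E _ ⟨j, rfl⟩).trans ?_
    change ((Equiv.ofInjective e he)
      ((Equiv.ofInjective _ (Fin.castLE_injective hle)).symm ⟨Fin.castLE hle j, ⟨j, rfl⟩⟩) :
        Fin k) = _
    rw [Equiv.ofInjective_symm_apply (Fin.castLE_injective hle) j]
    rfl
  have hσ' : ∀ a : Fin k, q + 1 ≤ a → ¬ g.right.SameCycle i (σ a) := by
    intro a ha hcon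
    obtain ⟨j, hj⟩ := (hrange _).1 hcon
    rw [← hσ] at hj
    have := σ.injective hj
    rw [← this] at ha
    exact absurd j.2 (not_lt.2 ha)
  refine ⟨hle, c, ⟨1, σ⟩, ConjClasses.mk (cycleProd c 0), ?_, ?_⟩
  · rw [fullType_of_transitive c htrans, cycleLabel, hlen]
  · rw [eq_mul_inv_iff_mul_eq]
    refine Wr.ext (fun l => ?_) (fun a => ?_)
    · obtain ⟨a, rfl⟩ := σ.surjective l
      rw [Wr.mul_left_apply, Wr.mul_left_apply]
      change _ * 1 = 1 * (incl hle c).left (σ⁻¹ (σ a))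
      rw [mul_one, one_mul, show σ⁻¹ (σ a) = a from σ.symm_apply_apply a]
      by_cases ha : q + 1 ≤ (a : ℕ)
      · rw [incl_left_of_le hle c ha]
        exact g.restrict_left_of_notMem _ hS (hσ' a ha)
      · obtain ⟨j, rfl⟩ : ∃ j, a = Fin.castLE hle j := ⟨⟨a, by omega⟩, rfl⟩
        rw [incl_left_castLE, hσ]
        exact g.restrict_left_of_mem _ hS ((hrange _).2 ⟨j, rfl⟩)
    · rw [Wr.mul_right_apply, Wr.mul_right_apply]
      change (g.restrict {j | g.right.SameCycle i j} hS).right (σ a) = σ ((incl hle c).right a)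
      by_cases ha : q + 1 ≤ (a : ℕ)
      · rw [incl_right_of_le hle c ha]
        exact g.restrict_right_of_notMem _ hS (hσ' a ha)
      · obtain ⟨j, rfl⟩ : ∃ j, a = Fin.castLE hle j := ⟨⟨a, by omega⟩, rfl⟩
        rw [incl_right_castLE, hσ, hσ]
        exact (g.restrict_right_of_mem _ hS ((hrange _).2 ⟨j, rfl⟩)).trans (hstep j).symm

end SingleCycle

/-! ### Decay of f at a general element and stability of AFP. -/

section Growth

variable {T : Type*} [Group T]

theorem eval_of_le (f : ∀ n, Wr T n → ℂ) {k n : ℕ} (h : k ≤ n) (g : Wr T k) :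
    eval f g n = f n (incl h g) := dif_pos h

/-- A sequence converging after rescaling is bounded by the inverse of the rescaling. -/
theorem isBigO_rpow_of_tendsto {u : ℕ → ℂ} {a : ℝ} {γ : ℂ}
    (h : Tendsto (fun n : ℕ => (((n : ℝ) ^ a : ℝ) : ℂ) * u n) atTop (𝓝 γ)) :
    u =O[atTop] fun n : ℕ => (n : ℝ) ^ (-a) := by
  have h1 := (isBigO_refl (fun n : ℕ => (n : ℝ) ^ (-a)) atTop).smul (h.isBigO_one ℝ)
  refine (h1.congr' ?_ (Eventually.of_forall fun n => by simp))
  filter_upwards [eventually_gt_atTop 0] with n hn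
  have hn' : (0 : ℝ) < n := by exact_mod_cast hn
  rw [Complex.real_smul, ← mul_assoc, ← Complex.ofReal_mul, ← Real.rpow_add hn']
  simp

/-- For one cycle of length p the defect is p - 1, exactly the scaling in `CycleLimits`; conjugation
invariance removes the dependence on where the cycle sits. -/
theorem CycleLimits.isBigO_restrict {f : ∀ n, Wr T n → ℂ} (hlim : CycleLimits f)
    (hconj : ∀ n (d g : Wr T n), f n (d * g * d⁻¹) = f n g) {k : ℕ} (g : Wr T k) (i : Fin k)
    (hS : ∀ j, g.right j ∈ {j | g.right.SameCycle i j} ↔ j ∈ {j | g.right.SameCycle i j}) :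
    eval f (g.restrict {j | g.right.SameCycle i j} hS) =O[atTop]
      fun n : ℕ => (n : ℝ) ^ (-(1 / 2 : ℝ) *
        defect (g.restrict {j | g.right.SameCycle i j} hS).right) := by
  classical
  have hdef : defect (g.restrict {j | g.right.SameCycle i j} hS).right =
      (cycleLength g i : ℝ) - 1 := by
    refine Eq.trans ?_ (sum_sameCycle g.right i)
    rw [Wr.defect_restrict, Finset.sum_filter]
    exact Finset.sum_congr rfl fun j _ => by
      by_cases h : g.right.SameCycle i j
      · exact (if_pos h).trans (if_pos h).symm
      · exact (if_neg h).trans (if_neg h).symm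
  obtain ⟨h, c, d, θ, hc, hd⟩ := exists_conj_restrict_sameCycle g i hS
  obtain ⟨γ, hγ⟩ := hlim θ (cycleLength g i) (minimalPeriod_perm_pos g.right i)
  have h1 := isBigO_rpow_of_tendsto (hγ c hc)
  rw [hdef, show -(1 / 2 : ℝ) * ((cycleLength g i : ℝ) - 1) = -(((cycleLength g i : ℝ) - 1) / 2)
    by ring]
  refine h1.congr' ?_ EventuallyEq.rfl
  filter_upwards [eventually_ge_atTop k] with n hn
  rw [eval_of_le f (h.trans hn), eval_of_le f hn, hd, map_mul, map_mul, map_inv, hconj, incl_incl]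

theorem CycleLimits.isBigO_one {f : ∀ n, Wr T n → ℂ} (hlim : CycleLimits f) (k : ℕ) :
    eval f (1 : Wr T k) =O[atTop] fun _ : ℕ => (1 : ℝ) := by
  -- The identity of 𝔖_1(T) is a single cycle of length 1, with scaling exponent 0; this bounds f at
  -- the identity without using normalization.
  obtain ⟨γ, hγ⟩ := hlim (cycleLabel (1 : Wr T 1) 0).1 1 le_rfl
  have hfull : fullType (1 : Wr T 1) = {((cycleLabel (1 : Wr T 1) 0).1, 1)} := by
    rw [fullType_of_transitive (1 : Wr T 1) fun j => by rw [Fin.fin_one_eq_zero j]]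
    congr 1
    exact Prod.ext rfl (Function.minimalPeriod_eq_one_iff_isFixedPt.2 rfl)
  have h1 := isBigO_rpow_of_tendsto (hγ 1 hfull)
  refine h1.congr' ?_ (Eventually.of_forall fun n => by simp)
  filter_upwards [eventually_ge_atTop k, eventually_ge_atTop 1] with n hn hn1
  rw [eval_of_le f hn, eval_of_le f hn1, map_one, map_one]

theorem rpow_neg_half_add_eventuallyEq (a b : ℝ) :
    (fun n : ℕ => (n : ℝ) ^ (-(1 / 2 : ℝ) * a) * (n : ℝ) ^ (-(1 / 2 : ℝ) * b)) =ᶠ[atTop]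
      fun n : ℕ => (n : ℝ) ^ (-(1 / 2 : ℝ) * (a + b)) := by
  filter_upwards [eventually_gt_atTop 0] with n hn
  have hn' : (0 : ℝ) < n := by exact_mod_cast hn
  rw [← Real.rpow_add hn']
  congr 1
  ring

/-- Under AFP and convergence at single cycles, `f^{(n)}(g)` decays at the rate prescribed by the
type of `g`. -/
theorem AFP.isBigO_eval {f : ∀ n, Wr T n → ℂ} (hAFP : AFP f) (hlim : CycleLimits f)
    (hconj : ∀ n (d g : Wr T n), f n (d * g * d⁻¹) = f n g) {k : ℕ} (g : Wr T k) :
    eval f g =O[atTop] fun n : ℕ => (n : ℝ) ^ (-(1 / 2 : ℝ) * defect g.right) := by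
  induction hs : (supp g).ncard using Nat.strong_induction_on generalizing g with
  | _ s ih =>
    rcases (supp g).eq_empty_or_nonempty with hemp | ⟨i, hi⟩
    · have hg : g = 1 := by
        refine Wr.ext (fun j => ?_) (fun j => ?_) <;>
        · have hj : j ∉ supp g := by simp [hemp]
          simp only [supp, Set.mem_ofPred_eq, not_or, ne_eq, not_not] at hj
          first | exact hj.2 | exact hj.1
      subst hg
      have h0 : defect (1 : Wr T k).right = 0 := by
        refine Finset.sum_eq_zero fun j _ => ?_
        rw [Function.minimalPeriod_eq_one_iff_isFixedPt.2
          (show Function.IsFixedPt (1 : Wr T k).right j from rfl)]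
        simp
      rw [h0]
      simpa using hlim.isBigO_one k
    · let S : Set (Fin k) := {j | g.right.SameCycle i j}
      have hS : ∀ j, g.right j ∈ S ↔ j ∈ S := fun j => Equiv.Perm.sameCycle_apply_right
      have hS' : ∀ j, g.right j ∈ Sᶜ ↔ j ∈ Sᶜ := fun j => not_congr (hS j)
      have hiS : i ∈ S := Equiv.Perm.SameCycle.refl _ _
      -- Induction on the number of letters in the support: splitting off the cycle through i
      -- removes at least i.
      have hlt : (supp (g.restrict Sᶜ hS')).ncard < s := by
        rw [← hs, Wr.supp_restrict]
        exact Set.ncard_lt_ncard ⟨Set.inter_subset_left, fun h => (h hi).2 hiS⟩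
      have hd : Disjoint (supp (g.restrict S hS)) (supp (g.restrict Sᶜ hS')) := by
        rw [Wr.supp_restrict, Wr.supp_restrict]
        exact (disjoint_compl_right (a := S)).mono Set.inter_subset_right Set.inter_subset_right
      have hsum : defect g.right =
          defect (g.restrict S hS).right + defect (g.restrict Sᶜ hS').right := by
        classical
        rw [Wr.defect_restrict, Wr.defect_restrict, defect, ← Finset.sum_add_distrib]
        refine Finset.sum_congr rfl fun j _ => ?_
        by_cases hj : j ∈ S <;> simp [hj]
      -- The AFP error already has the order wanted for g, since the defects of the two parts add up
      -- to that of g.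
      have h1 := (hAFP k _ _ hd).isBigO
      simp only [size_sub_length_redType, ← hsum, g.restrict_mul_restrict_compl S hS hS'] at h1
      have h2 := ((hlim.isBigO_restrict hconj g i hS).mul (ih _ hlt _ rfl)).trans
        (rpow_neg_half_add_eventuallyEq _ _).isBigO
      rw [← hsum] at h2
      exact (h1.add h2).congr_left fun n => sub_add_cancel _ _

end Growth


theorem fourier_conj {G : Type*} [Group G] [Finite G] (M : Irr G → ℝ) (d g : G) :
    fourier M (d * g * d⁻¹) = fourier M g := by
  unfold fourier
  refine Finset.sum_congr rfl fun lam _ => ?_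
  rw [show lam.character (d * g * d⁻¹) = lam.character g from Representation.char_conj _ _ _]

/-- AFP is preserved by multiplication with factors that depend on the number of moved letters and
are asymptotically multiplicative. -/
theorem AFP.mul_factor {T : Type*} [Group T] {f F : ∀ n, Wr T n → ℂ} (hAFP : AFP f)
    (hlim : CycleLimits f) (hconj : ∀ n (d g : Wr T n), f n (d * g * d⁻¹) = f n g)
    (E : ℕ → ℕ → ℂ) (c : ℂ)
    (hE : ∀ a : ℕ, Tendsto (E a) atTop (𝓝 (Complex.exp ((a : ℂ) * c))))
    (hF : ∀ n, 1 ≤ n → ∀ g, F n g = E (supp g).ncard n * f n g) : AFP F := by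
  intro k g h hd
  have hFe : ∀ u : Wr T k, ∀ n, k ≤ n → 1 ≤ n →
      eval F u n = E (supp u).ncard n * eval f u n := by
    intro u n hkn hn
    rw [eval_of_le F hkn, eval_of_le f hkn, hF n hn, ncard_supp_incl]
  have hcard : (supp (g * h)).ncard = (supp g).ncard + (supp h).ncard := by
    rw [Wr.supp_mul hd, Set.ncard_union_eq hd]
  have h1 := ((hE (supp (g * h)).ncard).isBigO_one ℝ).mul_isLittleO (hAFP k g h hd)
  -- Support sizes add, and exp((a + b)c) = exp(ac) exp(bc), so the limits cancel.
  have h2 : (fun n => E (supp (g * h)).ncard n - E (supp g).ncard n * E (supp h).ncard n)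
      =o[atTop] fun _ => (1 : ℝ) := by
    rw [isLittleO_one_iff]
    have h3 := (hE (supp (g * h)).ncard).sub ((hE (supp g).ncard).mul (hE (supp h).ncard))
    rw [← Complex.exp_add, hcard] at h3
    simpa [add_mul, hcard] using h3
  have h4 := h2.mul_isBigO (((hAFP.isBigO_eval hlim hconj g).mul
    (hAFP.isBigO_eval hlim hconj h)).trans (rpow_neg_half_add_eventuallyEq _ _).isBigO)
  simp only [size_sub_length_redType] at h1 ⊢
  simp only [one_mul] at h1 h4
  refine (h1.add h4).congr' ?_ EventuallyEq.rfl
  filter_upwards [eventually_ge_atTop k, eventually_ge_atTop 1] with n hkn hn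
  rw [hFe _ n hkn hn, hFe _ n hkn hn, hFe _ n hkn hn]
  ring

end WreathAFP

end

/-! ### Assembly. -/

theorem proposition4p4 {T : Type*} [Group T] [Finite T]
    (ψ : Measure ℝ) [IsProbabilityMeasure ψ] (hψpos : ψ (Set.Iic 0) = 0)
    (m : ℝ) (hψint : Integrable (fun x : ℝ => x) ψ) (hψmean : ∫ x, x ∂ψ = m)
    (hψchar : ∃ a : ℝ, 0 < a ∧
      IntegrableOn (fun ξ : ℝ => ‖charFun ψ ξ / (ξ : ℂ)‖) {ξ : ℝ | a ≤ |ξ|} volume)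
    {Ω : ℕ → Type*} [∀ n, MeasurableSpace (Ω n)]
    (P : ∀ n, Measure (Ω n)) [∀ n, IsProbabilityMeasure (P n)]
    (Z : ∀ n, ℕ → Ω n → WreathAFP.Irr (WreathAFP.Wr T n))
    (τ : ∀ n, ℕ → Ω n → ℝ)
    (hX : ∀ n, 1 ≤ n → WreathAFP.IsResIndDynamics n ψ (P n) (Z n) (τ n))
    (f : ℝ → ∀ n, WreathAFP.Wr T n → ℂ)
    (hf : ∀ t n, f t n = WreathAFP.fourier (WreathAFP.lawAt (P n) (Z n) (τ n) (t * n)))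
    (hlim : WreathAFP.CycleLimits (f 0))
    (hAFP : WreathAFP.AFP (f 0))
    (t : ℝ) (ht : 0 ≤ t) :
    WreathAFP.AFP (f t) := by
  -- The renewal limit needs t > 0; at t = 0 the claim is the hypothesis itself.
  rcases ht.eq_or_lt with rfl | htpos
  · exact hAFP
  have hconj : ∀ n (d g : WreathAFP.Wr T n), f 0 n (d * g * d⁻¹) = f 0 n g := fun n d g => by
    rw [hf, WreathAFP.fourier_conj]
  -- Time 0 enters through N_0, which vanishes almost surely because the pausing times are positive;
  -- so `f 0` is the transform of the initial law of the chain.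
  have hzero : ∀ n, 1 ≤ n → ∀ g, f 0 n g =
      WreathAFP.fourier (fun lam => (P n).real {ω | Z n 0 ω = lam}) g := by
    intro n hn g
    rw [hf, zero_mul, (hX n hn).fourier_lawAt hn]
    have h1 : ∫ x, (1 - ((WreathAFP.supp g).ncard : ℂ) / n) ^ WreathAFP.seqCounting 0 x
        ∂Measure.infinitePi (fun _ : ℕ => ψ) = ∫ _x : ℕ → ℝ, (1 : ℂ)
          ∂Measure.infinitePi (fun _ : ℕ => ψ) := by
      refine integral_congr_ae ?_
      filter_upwards [WreathAFP.ae_pos_infinitePi hψpos] with x hx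
      rw [WreathAFP.seqCounting_zero hx, pow_zero]
    rw [h1]
    simp
  refine hAFP.mul_factor hlim hconj (fun a n => ∫ x, (1 - (a : ℂ) / n) ^
    WreathAFP.seqCounting (t * n) x ∂Measure.infinitePi (fun _ : ℕ => ψ))
    (-((t / m : ℝ) : ℂ)) (fun a => ?_) fun n hn g => ?_
  · rw [mul_neg, ← hψmean]
    exact WreathAFP.tendsto_integral_one_sub_div_pow hψpos hψint htpos a
  · rw [hf, (hX n hn).fourier_lawAt hn, hzero n hn]
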